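/- **Setting.** A *compact quantum group* $G$ is given by a compact quantum group algebra $A_G$: a Hopf $*$-algebra over $\mathbb C$ generated as an algebra by the matrix coefficients of its finite-dimensional unitary corepresentations. $\mathrm{Rep}(G)$ is the monoidal dagger category of finite-dimensional unitary corepresentations $\delta: V \to V \otimes A_G$ and intertwiners, with $f^\dagger$ the Hilbert space adjoint. $\mathrm{Hilb}$ is the category of finite-dimensional Hilbert spaces and linear maps. A *fibre functor* is a faithful $\mathbb C$-linear monoidal functor $U: \mathrm{Rep}(G) \to \mathrm{Hilb}$ which is unitary: $U(f^\dagger) = U(f)^\dagger$, and the multiplicators $\mu_{X,Y}: U(X)\otimes U(Y) \to U(X \otimes Y)$ and the unitor $\upsilon:\mathbb C \to U(\mathbb 1)$ are unitary. The *canonical* fibre functor $F$ takes a corepresentation to its Hilbert space and an intertwiner to its linear map. A *unitary pseudonatural transformation* (UPT) $(\alpha,H): F_1 \to F_2$ of fibre functors is a finite-dimensional Hilbert space $H$ with unitaries $\alpha_X: F_1(X) \otimes H \to H \otimes F_2(X)$ such that $\alpha_Y (F_1(f) \otimes \mathrm{id}) = (\mathrm{id} \otimes F_2(f)) \alpha_X$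 for all $f: X \to Y$, $\alpha_{X \otimes Y}(\mu^1_{X,Y} \otimes \mathrm{id}) = (\mathrm{id} \otimes \mu^2_{X,Y})(\alpha_X \otimes \mathrm{id})(\mathrm{id} \otimes \alpha_Y)$ and $\alpha_{\mathbb 1}(\upsilon_1 \otimes \mathrm{id}) = \mathrm{id} \otimes \upsilon_2$. A *Frobenius algebra* $[A,m,u]$ in a monoidal dagger category is a monoid object with $(\mathrm{id}\otimes m)(m^\dagger \otimes \mathrm{id}) = m^\dagger m = (m \otimes \mathrm{id})(\mathrm{id} \otimes m^\dagger)$. It is *special* if $m m^\dagger = \mathrm{id}$, and *standard* if $u^\dagger m (f \otimes \mathrm{id}) m^\dagger u = u^\dagger m(\mathrm{id} \otimes f) m^\dagger u$ for all $f \in \mathrm{End}(A)$; an SSFA is a standard special Frobenius algebra. A morphism $f: A \to B$ between Frobenius algebras is a *channel* if $u_B^\dagger f = u_A^\dagger$ and $(\mathrm{id}_A \otimes m_B)(\mathrm{id}_A \otimes f \otimes \mathrm{id}_B)(m_A^\dagger \otimes \mathrm{id}_B) = g^\dagger g$ for some morphism $g$ out of $A \otimes B$. A fibre functor $U$ takes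 $[A,m,u]$ to the Frobenius algebra $U([A,m,u]) = [U(A), U(m)\mu_{A,A}, U(u)\upsilon]$ in $\mathrm{Hilb}$. The tensor product of Frobenius algebras in $\mathrm{Hilb}$ is formed with the swap map. For a Hilbert space $H \neq 0$ of dimension $d$ with orthonormal basis $\{|i\rangle\}$, let $\mathrm{cap}: |i\rangle \otimes |j\rangle \mapsto \delta_{ij}$ and $\mathrm{cup}: 1 \mapsto \sum_i |i\rangle \otimes |i\rangle$. $B(H)$ denotes the Frobenius algebra on $H \otimes H$ with multiplication $\frac{1}{\sqrt d}(\mathrm{id} \otimes \mathrm{cap} \otimes \mathrm{id})$ and unit $\sqrt d\,\mathrm{cup}$, and $\Psi: \mathbb C \to B(H) \otimes B(H)$, $1 \mapsto \frac{1}{d^2} \sum_{i,j} (|i\rangle \otimes |j\rangle) \otimes (|i\rangle \otimes |j\rangle)$, initialises the maximally entangled state. For Frobenius algebras $X, Y, A, B$ in $\mathrm{Hilb}$ and maps $T: X \to Y$, $N: A \to B$, an *entanglement-assisted channel coding scheme* $(E,D,H)$ for $T$ from $N$ consists of channels $E: X \otimes B(H) \to A$ and $D: B \otimes B(H) \to Y$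 with $$D \circ (N \otimes \mathrm{id}_{B(H)}) \circ (E \otimes \mathrm{id}_{B(H)}) \circ (\mathrm{id}_X \otimes \Psi) = T .$$ **Statement.** Let $G$ be a compact quantum group, $F$ the canonical fibre functor on $\mathrm{Rep}(G)$, $F'$ a fibre functor on $\mathrm{Rep}(G)$, and $(\alpha,H_e): F \to F'$ a UPT with $H_e \neq 0$; put $d = \dim H_e$ and fix an orthonormal basis $\{|i\rangle\}$ of $H_e$. Write $\alpha_X(x \otimes |k\rangle) = \sum_j |j\rangle \otimes \alpha_X^{jk}(x)$ with $\alpha_X^{jk}: F(X) \to F'(X)$. For an SSFA $[A,m,u]$ in $\mathrm{Rep}(G)$ define $$u_{[A,m,u]}: F([A,m,u]) \otimes B(H_e) \to F'([A,m,u]), \quad x \otimes |j\rangle \otimes |k\rangle \mapsto \sqrt d\, \alpha_A^{jk}(x),$$ $$v_{[A,m,u]}: F'([A,m,u]) \otimes B(H_e) \to F([A,m,u]), \quad y \otimes |j\rangle \otimes |k\rangle \mapsto \sqrt d\, (\alpha_A^{jk})^\dagger(y).$$ Let $f: [A_1,m_1,u_1] \to [A_2,m_2,u_2]$ be a channel between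 SSFAs in $\mathrm{Rep}(G)$. Then $F(f): F([A_1,m_1,u_1]) \to F([A_2,m_2,u_2])$ and $F'(f): F'([A_1,m_1,u_1]) \to F'([A_2,m_2,u_2])$ are channels, and * $(u_{[A_1,m_1,u_1]}, v_{[A_2,m_2,u_2]}, H_e)$ is an entanglement-assisted channel coding scheme for $F(f)$ from $F'(f)$; * $(v_{[A_1,m_1,u_1]}, u_{[A_2,m_2,u_2]}, H_e)$ is an entanglement-assisted channel coding scheme for $F'(f)$ from $F(f)$. -/

import Mathlib

open CategoryTheory MonoidalCategory TensorProduct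

set_option linter.unusedSectionVars false

noncomputable section

namespace EntSym

/-! ### Dagger categories and Frobenius algebras -/

/-- A dagger category: an involutive, identity-on-objects contravariant functor. -/
class DaggerCategory (C : Type*) [Category C] where
  dag : ∀ {X Y : C}, (X ⟶ Y) → (Y ⟶ X)
  dag_id : ∀ X : C, dag (𝟙 X) = 𝟙 X
  dag_comp : ∀ {X Y Z : C} (f : X ⟶ Y) (g : Y ⟶ Z), dag (f ≫ g) = dag g ≫ dag f
  dag_dag : ∀ {X Y : C} (f : X ⟶ Y), dag (dag f) = f

open DaggerCategory

/-- A morphism is unitary if it is both an isometry and a coisometry. -/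
def IsUnitary {C : Type*} [Category C] [DaggerCategory C] {X Y : C} (f : X ⟶ Y) : Prop :=
  f ≫ dag f = 𝟙 X ∧ dag f ≫ f = 𝟙 Y

lemma isUnitary_id {C : Type*} [Category C] [DaggerCategory C] (X : C) : IsUnitary (𝟙 X) := by
  constructor <;> rw [dag_id, Category.comp_id]

/-- A (dagger) Frobenius algebra `[X, m, u]`: a monoid object which satisfies the Frobenius
equations `(id ⊗ m) ∘ (m† ⊗ id) = m† ∘ m = (m ⊗ id) ∘ (id ⊗ m†)`. -/
structure FrobAlg (C : Type*) [Category C] [MonoidalCategory C] [DaggerCategory C] where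
  X : C
  [mon : MonObj X]
  frob_left : dag (MonObj.mul (X := X)) ▷ X ≫ (α_ X X X).hom ≫ X ◁ MonObj.mul (X := X)
    = MonObj.mul (X := X) ≫ dag (MonObj.mul (X := X))
  frob_right : X ◁ dag (MonObj.mul (X := X)) ≫ (α_ X X X).inv ≫ MonObj.mul (X := X) ▷ X
    = MonObj.mul (X := X) ≫ dag (MonObj.mul (X := X))

namespace FrobAlg

attribute [instance] FrobAlg.mon

variable {C : Type*} [Category C] [MonoidalCategory C] [DaggerCategory C]

/-- The multiplication `m : A ⊗ A → A`. -/
abbrev m (A : FrobAlg C) : A.X ⊗ A.X ⟶ A.X := MonObj.mul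

/-- The unit `u : 1 → A`. -/
abbrev u (A : FrobAlg C) : 𝟙_ C ⟶ A.X := MonObj.one

/-- Speciality: `m ∘ m† = id`. -/
def IsSpecial (A : FrobAlg C) : Prop := dag A.m ≫ A.m = 𝟙 A.X

/-- The cup `m† ∘ u` of the self-duality of a Frobenius algebra. -/
def cup (A : FrobAlg C) : 𝟙_ C ⟶ A.X ⊗ A.X := A.u ≫ dag A.m

/-- The cap `u† ∘ m` of the self-duality of a Frobenius algebra. -/
def cap (A : FrobAlg C) : A.X ⊗ A.X ⟶ 𝟙_ C := A.m ≫ dag A.u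

/-- Standardness: the left and the right trace defined by the self-duality agree on every
endomorphism. -/
def IsStandard (A : FrobAlg C) : Prop :=
  ∀ f : A.X ⟶ A.X, A.cup ≫ f ▷ A.X ≫ A.cap = A.cup ≫ A.X ◁ f ≫ A.cap

/-- The CP condition: `(id ⊗ m_B) ∘ (id ⊗ f ⊗ id) ∘ (m_A† ⊗ id) = g† ∘ g` for some `g`. -/
def IsCP (A B : FrobAlg C) (f : A.X ⟶ B.X) : Prop :=
  ∃ (Z : C) (g : A.X ⊗ B.X ⟶ Z),
    dag A.m ▷ B.X ≫ (α_ A.X A.X B.X).hom ≫ A.X ◁ (f ▷ B.X ≫ B.m) = g ≫ dag g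

/-- A channel: a CP morphism which preserves the counit. -/
structure IsChannel (A B : FrobAlg C) (f : A.X ⟶ B.X) : Prop where
  cp : IsCP A B f
  counit : f ≫ dag B.u = dag A.u

end FrobAlg

/-! ### The category of finite-dimensional Hilbert spaces -/

/-- Finite-dimensional complex Hilbert spaces. -/
structure Hilb where
  carrier : Type
  [normed : NormedAddCommGroup carrier]
  [innerProd : InnerProductSpace ℂ carrier]
  [finite : FiniteDimensional ℂ carrier]

/-- To prove an equation which is additive in two tensors, check it on pure tensors. -/
lemma induction₂ {V W P Q : Type*} [AddCommGroup V] [Module ℂ V] [AddCommGroup W] [Module ℂ W]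
    [AddCommGroup P] [Module ℂ P] [AddCommGroup Q] [Module ℂ Q]
    {T : Type*} [AddCommGroup T] [Module ℂ T]
    {f g : (V ⊗[ℂ] P) ⊗[ℂ] (W ⊗[ℂ] Q) →ₗ[ℂ] T}
    (h : ∀ v p w q, f ((v ⊗ₜ p) ⊗ₜ (w ⊗ₜ q)) = g ((v ⊗ₜ p) ⊗ₜ (w ⊗ₜ q))) : f = g := by
  ext v p w q
  exact h v p w q

namespace Hilb

instance : CoeSort Hilb Type := ⟨Hilb.carrier⟩

attribute [instance] Hilb.normed Hilb.innerProd Hilb.finite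

/-- Morphisms of Hilbert spaces: linear maps. -/
@[ext]
structure Hom (V W : Hilb) where
  lin : V →ₗ[ℂ] W

instance : Category Hilb where
  Hom V W := Hom V W
  id V := ⟨LinearMap.id⟩
  comp f g := ⟨g.lin ∘ₗ f.lin⟩

@[ext]
lemma hom_ext {V W : Hilb} {f g : V ⟶ W} (h : f.lin = g.lin) : f = g := Hom.ext h

@[simp] lemma id_lin (V : Hilb) : Hom.lin (𝟙 V) = LinearMap.id := rfl
@[simp] lemma comp_lin {V W U : Hilb} (f : V ⟶ W) (g : W ⟶ U) :
    (f ≫ g).lin = g.lin ∘ₗ f.lin := rfl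

/-- Morphisms are the same as linear maps. -/
def homEquiv (V W : Hilb) : (V ⟶ W) ≃ (V →ₗ[ℂ] W) := ⟨Hom.lin, Hom.mk, fun _ => rfl, fun _ => rfl⟩

instance (V W : Hilb) : AddCommGroup (V ⟶ W) := (homEquiv V W).addCommGroup
instance (V W : Hilb) : Module ℂ (V ⟶ W) := (homEquiv V W).module ℂ

@[simp] lemma add_lin {V W : Hilb} (f g : V ⟶ W) : (f + g).lin = f.lin + g.lin := rfl
@[simp] lemma zero_lin {V W : Hilb} : (0 : V ⟶ W).lin = 0 := rfl
@[simp] lemma smul_lin {V W : Hilb} (c : ℂ) (f : V ⟶ W) : (c • f).lin = c • f.lin := rfl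

instance : Preadditive Hilb where
  add_comp _ _ _ _ _ _ := by ext; simp
  comp_add _ _ _ _ _ _ := by ext; simp

instance : Linear ℂ Hilb where
  smul_comp _ _ _ _ _ _ := by ext; simp
  comp_smul _ _ _ _ _ _ := by ext; simp

instance : DaggerCategory Hilb where
  dag f := ⟨LinearMap.adjoint f.lin⟩
  dag_id V := by ext1; simp
  dag_comp f g := by ext1; simp [LinearMap.adjoint_comp]
  dag_dag f := by ext1; simp

@[simp] lemma dag_lin {V W : Hilb} (f : V ⟶ W) : (dag f).lin = LinearMap.adjoint f.lin := rfl

/-- A linear equivalence as an isomorphism of the category. -/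
def isoOfEquiv {V W : Hilb} (e : V ≃ₗ[ℂ] W) : V ≅ W where
  hom := ⟨e.toLinearMap⟩
  inv := ⟨e.symm.toLinearMap⟩
  hom_inv_id := by ext; simp
  inv_hom_id := by ext; simp

@[simp] lemma isoOfEquiv_hom {V W : Hilb} (e : V ≃ₗ[ℂ] W) :
    (isoOfEquiv e).hom.lin = e.toLinearMap := rfl
@[simp] lemma isoOfEquiv_inv {V W : Hilb} (e : V ≃ₗ[ℂ] W) :
    (isoOfEquiv e).inv.lin = e.symm.toLinearMap := rfl

instance : MonoidalCategoryStruct Hilb where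
  tensorObj V W := ⟨V ⊗[ℂ] W⟩
  whiskerLeft V _ _ f := ⟨f.lin.lTensor V⟩
  whiskerRight f W := ⟨f.lin.rTensor W⟩
  tensorHom f g := ⟨TensorProduct.map f.lin g.lin⟩
  tensorUnit := ⟨ℂ⟩
  associator V W U := isoOfEquiv (TensorProduct.assoc ℂ V W U)
  leftUnitor V := isoOfEquiv (TensorProduct.lid ℂ V)
  rightUnitor V := isoOfEquiv (TensorProduct.rid ℂ V)

@[simp] lemma tensorObj_carrier (V W : Hilb) : (V ⊗ W : Hilb).carrier = (V ⊗[ℂ] W) := rfl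
@[simp] lemma tensorUnit_carrier : (𝟙_ Hilb).carrier = ℂ := rfl
@[simp] lemma whiskerLeft_lin (V : Hilb) {W U : Hilb} (f : W ⟶ U) :
    (V ◁ f).lin = f.lin.lTensor V := rfl
@[simp] lemma whiskerRight_lin {V W : Hilb} (f : V ⟶ W) (U : Hilb) :
    (f ▷ U).lin = f.lin.rTensor U := rfl
@[simp] lemma tensorHom_lin {V W U Z : Hilb} (f : V ⟶ W) (g : U ⟶ Z) :
    (f ⊗ₘ g).lin = TensorProduct.map f.lin g.lin := rfl
@[simp] lemma associator_hom_lin (V W U : Hilb) :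
    (α_ V W U).hom.lin = (TensorProduct.assoc ℂ V W U).toLinearMap := rfl
@[simp] lemma associator_inv_lin (V W U : Hilb) :
    (α_ V W U).inv.lin = (TensorProduct.assoc ℂ V W U).symm.toLinearMap := rfl
@[simp] lemma leftUnitor_hom_lin (V : Hilb) :
    (λ_ V).hom.lin = (TensorProduct.lid ℂ V).toLinearMap := rfl
@[simp] lemma leftUnitor_inv_lin (V : Hilb) :
    (λ_ V).inv.lin = (TensorProduct.lid ℂ V).symm.toLinearMap := rfl
@[simp] lemma rightUnitor_hom_lin (V : Hilb) :
    (ρ_ V).hom.lin = (TensorProduct.rid ℂ V).toLinearMap := rfl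
@[simp] lemma rightUnitor_inv_lin (V : Hilb) :
    (ρ_ V).inv.lin = (TensorProduct.rid ℂ V).symm.toLinearMap := rfl

instance : MonoidalCategory Hilb where
  tensorHom_def f g := by
    apply hom_ext; apply TensorProduct.ext'; intro x y; simp
  id_tensorHom_id V W := by
    apply hom_ext; apply TensorProduct.ext'; intro x y; simp
  tensorHom_comp_tensorHom f g h k := by
    apply hom_ext; apply TensorProduct.ext'; intro x y; simp
  whiskerLeft_id V W := by
    apply hom_ext; apply TensorProduct.ext'; intro x y; simp
  id_whiskerRight V W := by
    apply hom_ext; apply TensorProduct.ext'; intro x y; simp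
  associator_naturality f g h := by
    apply hom_ext; apply TensorProduct.ext_threefold; intro x y z; simp
  leftUnitor_naturality f := by
    apply hom_ext; apply TensorProduct.ext'; intro x y; simp
  rightUnitor_naturality f := by
    apply hom_ext; apply TensorProduct.ext'; intro x y; simp
  pentagon V W U Z := by
    apply hom_ext; apply TensorProduct.ext_fourfold; intro x y z w; simp
  triangle V W := by
    apply hom_ext; apply TensorProduct.ext_threefold; intro x y z
    exact (TensorProduct.smul_tmul (R := ℂ) (R' := ℂ) (show ℂ from y) x z).symm

instance : SymmetricCategory Hilb where
  braiding V W := isoOfEquiv (TensorProduct.comm ℂ V W)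
  braiding_naturality_right V _ _ f := by
    apply hom_ext; apply TensorProduct.ext'; intro x y; simp
  braiding_naturality_left f V := by
    apply hom_ext; apply TensorProduct.ext'; intro x y; simp
  hexagon_forward V W U := by
    apply hom_ext; apply TensorProduct.ext_threefold; intro x y z; simp
  hexagon_reverse V W U := by
    apply hom_ext; apply TensorProduct.ext'; intro x t
    induction t using TensorProduct.induction_on with
    | zero => simp
    | tmul y z => simp
    | add a b ha hb => simp only [TensorProduct.tmul_add, map_add, ha, hb]
  symmetry V W := by
    apply hom_ext; apply TensorProduct.ext'; intro x y; simp

@[simp] lemma braiding_hom_lin (V W : Hilb) :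
    (β_ V W).hom.lin = (TensorProduct.comm ℂ V W).toLinearMap := rfl

/-- A linear equivalence which preserves inner products has its inverse as adjoint. -/
lemma dag_isoOfEquiv {V W : Hilb} (e : V ≃ₗ[ℂ] W)
    (h : ∀ x y, inner ℂ (e x) (e y) = inner ℂ x y) :
    dag (isoOfEquiv e).hom = (isoOfEquiv e).inv := by
  apply hom_ext
  symm
  rw [dag_lin, LinearMap.eq_adjoint_iff]
  intro x y
  obtain ⟨x, rfl⟩ := e.surjective x
  simp only [isoOfEquiv_hom, isoOfEquiv_inv, LinearEquiv.coe_coe, LinearEquiv.symm_apply_apply, h]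

lemma dag_associator_hom (V W U : Hilb) : dag (α_ V W U).hom = (α_ V W U).inv :=
  dag_isoOfEquiv _ TensorProduct.inner_assoc_assoc

lemma dag_associator_inv (V W U : Hilb) : dag (α_ V W U).inv = (α_ V W U).hom := by
  rw [← dag_associator_hom, dag_dag]

lemma dag_braiding_hom (V W : Hilb) : dag (β_ V W).hom = (β_ V W).inv :=
  dag_isoOfEquiv _ TensorProduct.inner_comm_comm

@[simp] lemma braiding_inv_lin (V W : Hilb) :
    (β_ V W).inv.lin = (TensorProduct.comm ℂ V W).symm.toLinearMap := rfl

lemma dag_whiskerLeft (V : Hilb) {W U : Hilb} (f : W ⟶ U) : dag (V ◁ f) = V ◁ dag f :=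
  hom_ext (LinearMap.adjoint_lTensor _)

lemma dag_whiskerRight {W U : Hilb} (f : W ⟶ U) (V : Hilb) : dag (f ▷ V) = dag f ▷ V :=
  hom_ext (LinearMap.adjoint_rTensor _)

lemma dag_tensorHom {V W U Z : Hilb} (f : V ⟶ W) (g : U ⟶ Z) :
    dag (f ⊗ₘ g) = dag f ⊗ₘ dag g :=
  hom_ext (TensorProduct.adjoint_map _ _)

end Hilb

/-! ### Compact quantum groups and their unitary corepresentations -/

section Corep

variable {A : Type*} [Ring A] [HopfAlgebra ℂ A] [StarRing A] [StarModule ℂ A]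

/-- The map `⟨ξ| ⊗ id : V ⊗ A → A`. -/
def slice {V : Type*} [NormedAddCommGroup V] [InnerProductSpace ℂ V] (ξ : V) :
    V ⊗[ℂ] A →ₗ[ℂ] A :=
  (TensorProduct.lid ℂ A).toLinearMap ∘ₗ (innerₛₗ ℂ ξ).rTensor A

@[simp] lemma slice_tmul {V : Type*} [NormedAddCommGroup V] [InnerProductSpace ℂ V] (ξ v : V)
    (a : A) : slice ξ (v ⊗ₜ[ℂ] a) = inner ℂ ξ v • a := by
  simp [slice]

/-- The matrix coefficients `δ_ij = (⟨i| ⊗ id) (δ |j⟩)` in an orthonormal basis. -/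
def coeffMatrix {V : Type*} [NormedAddCommGroup V] [InnerProductSpace ℂ V] {ι : Type*} [Fintype ι]
    (b : OrthonormalBasis ι ℂ V) (δ : V →ₗ[ℂ] V ⊗[ℂ] A) : Matrix ι ι A :=
  fun i j => slice (b i) (δ (b j))

lemma sum_slice {V : Type*} [NormedAddCommGroup V] [InnerProductSpace ℂ V] {ι : Type*} [Fintype ι]
    (b : OrthonormalBasis ι ℂ V) (t : V ⊗[ℂ] A) : ∑ i, b i ⊗ₜ[ℂ] slice (b i) t = t := by
  induction t using TensorProduct.induction_on with
  | zero => simp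
  | tmul v a =>
    simp only [slice_tmul, ← TensorProduct.smul_tmul]
    rw [← TensorProduct.sum_tmul, b.sum_repr' v]
  | add s t hs ht => simp only [map_add, TensorProduct.tmul_add, Finset.sum_add_distrib, hs, ht]

lemma slice_ext {V : Type*} [NormedAddCommGroup V] [InnerProductSpace ℂ V] {ι : Type*} [Fintype ι]
    (b : OrthonormalBasis ι ℂ V) {s t : V ⊗[ℂ] A} (h : ∀ i, slice (b i) s = slice (b i) t) :
    s = t := by
  rw [← sum_slice b s, ← sum_slice b t]; simp [h]

section Matrices

variable {V W : Type*} [NormedAddCommGroup V] [InnerProductSpace ℂ V]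
  [NormedAddCommGroup W] [InnerProductSpace ℂ W]
  {ι κ : Type*} [Fintype ι] [Fintype κ]

/-- The matrix of a linear map in orthonormal bases, with entries in `A`. -/
def scalarMatrix (A : Type*) [Ring A] [Algebra ℂ A] (b : OrthonormalBasis ι ℂ V)
    (c : OrthonormalBasis κ ℂ W) (f : V →ₗ[ℂ] W) :
    Matrix κ ι A :=
  fun i j => algebraMap ℂ A (inner ℂ (c i) (f (b j)))

lemma coeff_mul_scalar (b : OrthonormalBasis ι ℂ V)
    (c : OrthonormalBasis κ ℂ W) (f : V →ₗ[ℂ] W) (δ : W →ₗ[ℂ] W ⊗[ℂ] A) (i : κ) (j : ι) :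
    (coeffMatrix c δ * scalarMatrix A b c f) i j = slice (c i) (δ (f (b j))) := by
  rw [Matrix.mul_apply]
  conv_rhs => rw [← c.sum_repr' (f (b j))]
  simp only [map_sum, map_smul, coeffMatrix, scalarMatrix]
  refine Finset.sum_congr rfl fun k _ => ?_
  rw [Algebra.smul_def, Algebra.commutes]

lemma scalar_mul_coeff (b : OrthonormalBasis ι ℂ V)
    (c : OrthonormalBasis κ ℂ W) (f : V →ₗ[ℂ] W) (δ : V →ₗ[ℂ] V ⊗[ℂ] A) (i : κ) (j : ι) :
    (scalarMatrix A b c f * coeffMatrix b δ) i j = slice (c i) (f.rTensor A (δ (b j))) := by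
  rw [Matrix.mul_apply]
  conv_rhs => rw [← sum_slice b (δ (b j))]
  simp only [map_sum, coeffMatrix, scalarMatrix, LinearMap.rTensor_tmul, slice_tmul,
    Algebra.smul_def]

lemma intertwines_iff (b : OrthonormalBasis ι ℂ V)
    (c : OrthonormalBasis κ ℂ W) (f : V →ₗ[ℂ] W) (δ : V →ₗ[ℂ] V ⊗[ℂ] A) (δ' : W →ₗ[ℂ] W ⊗[ℂ] A) :
    δ' ∘ₗ f = f.rTensor A ∘ₗ δ ↔
      coeffMatrix c δ' * scalarMatrix A b c f = scalarMatrix A b c f * coeffMatrix b δ := by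
  constructor
  · intro h
    ext i j
    rw [coeff_mul_scalar, scalar_mul_coeff]
    exact congrArg (slice (c i)) (LinearMap.congr_fun h (b j))
  · intro h
    refine b.toBasis.ext fun j => slice_ext c fun i => ?_
    have := congrFun (congrFun h i) j
    rw [coeff_mul_scalar, scalar_mul_coeff] at this
    simpa using this

lemma star_scalarMatrix [FiniteDimensional ℂ V] [FiniteDimensional ℂ W]
    (b : OrthonormalBasis ι ℂ V) (c : OrthonormalBasis κ ℂ W) (f : V →ₗ[ℂ] W) :
    (scalarMatrix A b c f).conjTranspose = scalarMatrix A c b (LinearMap.adjoint f) := by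
  ext i j
  simp only [Matrix.conjTranspose_apply, scalarMatrix]
  rw [← algebraMap_star_comm, LinearMap.adjoint_inner_right]
  congr 1
  exact inner_conj_symm _ _

lemma scalarMatrix_mul {U : Type*} [NormedAddCommGroup U] [InnerProductSpace ℂ U]
    {τ : Type*} [Fintype τ] (b : OrthonormalBasis ι ℂ V) (c : OrthonormalBasis κ ℂ W)
    (e : OrthonormalBasis τ ℂ U) (f : V →ₗ[ℂ] W) (g : W →ₗ[ℂ] U) :
    scalarMatrix A c e g * scalarMatrix A b c f = scalarMatrix A b e (g ∘ₗ f) := by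
  ext i j
  rw [Matrix.mul_apply]
  simp only [scalarMatrix, ← map_mul, ← map_sum]
  congr 1
  conv_rhs => rw [LinearMap.comp_apply, ← c.sum_repr' (f (b j))]
  simp only [map_sum, map_smul, inner_sum, inner_smul_right]
  exact Finset.sum_congr rfl fun k _ => mul_comm _ _

lemma scalarMatrix_id [DecidableEq ι] (b : OrthonormalBasis ι ℂ V) :
    scalarMatrix A b b LinearMap.id = 1 := by
  ext i j
  rw [scalarMatrix, LinearMap.id_apply, orthonormal_iff_ite.mp b.orthonormal i j,
    Matrix.one_apply]
  split <;> simp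

/-- The adjoint of an intertwiner of unitary corepresentations is an intertwiner. -/
lemma adjoint_intertwines [FiniteDimensional ℂ V] [FiniteDimensional ℂ W]
    [DecidableEq ι] [DecidableEq κ]
    (b : OrthonormalBasis ι ℂ V) (c : OrthonormalBasis κ ℂ W) (f : V →ₗ[ℂ] W)
    (δ : V →ₗ[ℂ] V ⊗[ℂ] A) (δ' : W →ₗ[ℂ] W ⊗[ℂ] A)
    (hδ : coeffMatrix b δ ∈ unitary (Matrix ι ι A))
    (hδ' : coeffMatrix c δ' ∈ unitary (Matrix κ κ A))
    (h : δ' ∘ₗ f = f.rTensor A ∘ₗ δ) :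
    δ ∘ₗ LinearMap.adjoint f = (LinearMap.adjoint f).rTensor A ∘ₗ δ' := by
  rw [intertwines_iff c b, ← star_scalarMatrix]
  rw [intertwines_iff b c] at h
  set D := coeffMatrix b δ
  set E := coeffMatrix c δ'
  set M := scalarMatrix A b c f
  have hD : D * D.conjTranspose = 1 := (Unitary.mem_iff.mp hδ).2
  have hE : E.conjTranspose * E = 1 := (Unitary.mem_iff.mp hδ').1
  have key : M * D.conjTranspose = E.conjTranspose * M := by
    calc M * D.conjTranspose = (E.conjTranspose * E) * M * D.conjTranspose := by
          rw [hE, Matrix.one_mul]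
      _ = E.conjTranspose * (E * M) * D.conjTranspose := by simp only [Matrix.mul_assoc]
      _ = E.conjTranspose * M * (D * D.conjTranspose) := by rw [h]; simp only [Matrix.mul_assoc]
      _ = E.conjTranspose * M := by rw [hD, Matrix.mul_one]
  have := congrArg Matrix.conjTranspose key
  simpa [Matrix.conjTranspose_mul] using this

/-- Unitarity of the matrix of coefficients does not depend on the orthonormal basis. -/
lemma coeffMatrix_unitary_of_basis [DecidableEq ι] [DecidableEq κ]
    (b : OrthonormalBasis ι ℂ V) (c : OrthonormalBasis κ ℂ V) (δ : V →ₗ[ℂ] V ⊗[ℂ] A)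
    (hδ : coeffMatrix b δ ∈ unitary (Matrix ι ι A)) :
    coeffMatrix c δ ∈ unitary (Matrix κ κ A) := by
  have : FiniteDimensional ℂ V := b.toBasis.finiteDimensional_of_finite
  have h := (intertwines_iff b c LinearMap.id δ δ).mp (by simp)
  have h2 : scalarMatrix A b c LinearMap.id * scalarMatrix A c b LinearMap.id = 1 := by
    rw [scalarMatrix_mul, LinearMap.id_comp, scalarMatrix_id]
  have h3 : scalarMatrix A c b LinearMap.id * scalarMatrix A b c LinearMap.id = 1 := by
    rw [scalarMatrix_mul, LinearMap.id_comp, scalarMatrix_id]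
  have h4 : (scalarMatrix A b c LinearMap.id).conjTranspose = scalarMatrix A c b LinearMap.id := by
    rw [star_scalarMatrix, LinearMap.adjoint_id]
  have h5 : (scalarMatrix A c b LinearMap.id).conjTranspose = scalarMatrix A b c LinearMap.id := by
    rw [star_scalarMatrix, LinearMap.adjoint_id]
  set D := coeffMatrix b δ
  set E := coeffMatrix c δ
  set M := scalarMatrix A b c LinearMap.id
  set N := scalarMatrix A c b LinearMap.id
  obtain ⟨hD1, hD2⟩ := Unitary.mem_iff.mp hδ
  rw [Matrix.star_eq_conjTranspose] at hD1 hD2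
  have hE : E = M * D * N := by rw [← h, Matrix.mul_assoc, h2, Matrix.mul_one]
  have hEs : E.conjTranspose = M * D.conjTranspose * N := by
    rw [hE]; simp [Matrix.conjTranspose_mul, h4, h5, Matrix.mul_assoc]
  rw [Unitary.mem_iff, Matrix.star_eq_conjTranspose, hEs, hE]
  constructor
  · calc M * D.conjTranspose * N * (M * D * N)
        = M * D.conjTranspose * (N * M) * D * N := by simp only [Matrix.mul_assoc]
      _ = M * (D.conjTranspose * D) * N := by rw [h3, Matrix.mul_one]; simp only [Matrix.mul_assoc]
      _ = 1 := by rw [hD1, Matrix.mul_one, h2]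
  · calc M * D * N * (M * D.conjTranspose * N)
        = M * D * (N * M) * D.conjTranspose * N := by simp only [Matrix.mul_assoc]
      _ = M * (D * D.conjTranspose) * N := by rw [h3, Matrix.mul_one]; simp only [Matrix.mul_assoc]
      _ = 1 := by rw [hD2, Matrix.mul_one, h2]

end Matrices

variable (A) in
/-- Finite-dimensional unitary corepresentations of `A`, i.e. finite-dimensional continuous
unitary representations of the compact quantum group `G` with `A = A_G`. -/
structure UCorep where
  V : Hilb
  δ : V →ₗ[ℂ] V ⊗[ℂ] A
  coassoc : (TensorProduct.assoc ℂ V A A).toLinearMap ∘ₗ δ.rTensor A ∘ₗ δ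
    = (Coalgebra.comul (R := ℂ) (A := A)).lTensor V ∘ₗ δ
  counit : (TensorProduct.rid ℂ V).toLinearMap ∘ₗ (Coalgebra.counit (R := ℂ) (A := A)).lTensor V ∘ₗ δ
    = LinearMap.id
  isUnitary : ∀ (n : ℕ) (b : OrthonormalBasis (Fin n) ℂ V),
    coeffMatrix b δ ∈ unitary (Matrix (Fin n) (Fin n) A)

variable (A) in
/-- `A` is a compact quantum group algebra: a Hopf `*`-algebra which is generated as an algebra by
the matrix coefficients of its finite-dimensional unitary corepresentations. -/
class IsCQGAlgebra : Prop where
  comul_star : ∀ a : A, Coalgebra.comul (R := ℂ) (star a) = star (Coalgebra.comul (R := ℂ) a)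
  generated : Algebra.adjoin ℂ {a : A | ∃ (X : UCorep A) (n : ℕ)
    (b : OrthonormalBasis (Fin n) ℂ X.V) (i j : Fin n), a = coeffMatrix b X.δ i j} = ⊤

namespace UCorep

/-- Morphisms of `Rep(G)`: intertwiners. -/
@[ext]
structure Hom (X Y : UCorep A) where
  hom : X.V ⟶ Y.V
  comm : Y.δ ∘ₗ hom.lin = hom.lin.rTensor A ∘ₗ X.δ

instance : Category (UCorep A) where
  Hom X Y := Hom X Y
  id X := ⟨𝟙 X.V, by simp⟩
  comp {X Y Z} f g := ⟨f.hom ≫ g.hom, by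
    rw [Hilb.comp_lin, ← LinearMap.comp_assoc, g.comm, LinearMap.comp_assoc, f.comm,
      ← LinearMap.comp_assoc, ← LinearMap.rTensor_comp]⟩

@[ext]
lemma hom_ext {X Y : UCorep A} {f g : X ⟶ Y} (h : f.hom = g.hom) : f = g := Hom.ext h

@[simp] lemma id_hom (X : UCorep A) : Hom.hom (𝟙 X) = 𝟙 X.V := rfl
@[simp] lemma comp_hom {X Y Z : UCorep A} (f : X ⟶ Y) (g : Y ⟶ Z) :
    (f ≫ g).hom = f.hom ≫ g.hom := rfl

/-- The space of intertwiners as a subspace of the linear maps. -/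
def homSubmodule (X Y : UCorep A) : Submodule ℂ (X.V ⟶ Y.V) where
  carrier := {f | Y.δ ∘ₗ f.lin = f.lin.rTensor A ∘ₗ X.δ}
  add_mem' {f g} hf hg := by
    simp only [Set.mem_ofPred_eq] at hf hg ⊢
    rw [Hilb.add_lin, LinearMap.comp_add, hf, hg, LinearMap.rTensor_add, LinearMap.add_comp]
  zero_mem' := by simp
  smul_mem' c f hf := by
    simp only [Set.mem_ofPred_eq] at hf ⊢
    rw [Hilb.smul_lin, LinearMap.comp_smul, hf, LinearMap.rTensor_smul, LinearMap.smul_comp]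

/-- Intertwiners as elements of the subspace of intertwining maps. -/
def homEquiv (X Y : UCorep A) : (X ⟶ Y) ≃ homSubmodule X Y :=
  ⟨fun f => ⟨f.hom, f.comm⟩, fun f => ⟨f.1, f.2⟩, fun _ => rfl, fun _ => rfl⟩

instance (X Y : UCorep A) : AddCommGroup (X ⟶ Y) := (homEquiv X Y).addCommGroup
instance (X Y : UCorep A) : Module ℂ (X ⟶ Y) := (homEquiv X Y).module ℂ

@[simp] lemma add_hom {X Y : UCorep A} (f g : X ⟶ Y) : (f + g).hom = f.hom + g.hom := rfl
@[simp] lemma zero_hom {X Y : UCorep A} : (0 : X ⟶ Y).hom = 0 := rfl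
@[simp] lemma smul_hom {X Y : UCorep A} (c : ℂ) (f : X ⟶ Y) : (c • f).hom = c • f.hom := rfl

instance : Preadditive (UCorep A) where
  add_comp _ _ _ _ _ _ := by ext1; simp
  comp_add _ _ _ _ _ _ := by ext1; simp

instance : Linear ℂ (UCorep A) where
  smul_comp _ _ _ _ _ _ := by ext1; simp
  comp_smul _ _ _ _ _ _ := by ext1; simp

instance : DaggerCategory (UCorep A) where
  dag {X Y} f := ⟨dag f.hom, adjoint_intertwines (stdOrthonormalBasis ℂ X.V)
    (stdOrthonormalBasis ℂ Y.V) f.hom.lin X.δ Y.δ (X.isUnitary _ _) (Y.isUnitary _ _) f.comm⟩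
  dag_id X := hom_ext (dag_id X.V)
  dag_comp f g := hom_ext (dag_comp f.hom g.hom)
  dag_dag f := hom_ext (dag_dag f.hom)

@[simp] lemma dag_hom {X Y : UCorep A} (f : X ⟶ Y) : (dag f).hom = dag f.hom := rfl

/-- The map `v ⊗ a ⊗ w ⊗ b ↦ v ⊗ w ⊗ a b`. -/
def mulShuffle (B V W : Type*) [Ring B] [Algebra ℂ B] [AddCommGroup V] [Module ℂ V]
    [AddCommGroup W] [Module ℂ W] : (V ⊗[ℂ] B) ⊗[ℂ] (W ⊗[ℂ] B) →ₗ[ℂ] (V ⊗[ℂ] W) ⊗[ℂ] B :=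
  (LinearMap.mul' ℂ B).lTensor (V ⊗[ℂ] W) ∘ₗ
    (TensorProduct.tensorTensorTensorComm ℂ V B W B).toLinearMap

@[simp] lemma mulShuffle_tmul {B V W : Type*} [Ring B] [Algebra ℂ B] [AddCommGroup V] [Module ℂ V]
    [AddCommGroup W] [Module ℂ W] (v : V) (a : B) (w : W) (b : B) :
    mulShuffle B V W ((v ⊗ₜ[ℂ] a) ⊗ₜ[ℂ] (w ⊗ₜ[ℂ] b)) = (v ⊗ₜ[ℂ] w) ⊗ₜ[ℂ] (a * b) := by
  simp [mulShuffle]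

/-- The inverse of an invertible intertwining map is intertwining. -/
lemma inv_comm {V W : Type*} [AddCommGroup V] [Module ℂ V] [AddCommGroup W] [Module ℂ W]
    (e : V ≃ₗ[ℂ] W) (δ : V →ₗ[ℂ] V ⊗[ℂ] A) (δ' : W →ₗ[ℂ] W ⊗[ℂ] A)
    (h : δ' ∘ₗ e.toLinearMap = e.toLinearMap.rTensor A ∘ₗ δ) :
    δ ∘ₗ e.symm.toLinearMap = e.symm.toLinearMap.rTensor A ∘ₗ δ' := by
  apply LinearMap.ext
  intro w
  obtain ⟨v, rfl⟩ := e.surjective w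
  have := LinearMap.congr_fun h v
  simp only [LinearMap.comp_apply, LinearEquiv.coe_coe] at this ⊢
  rw [this, LinearEquiv.symm_apply_apply, ← LinearMap.comp_apply, ← LinearMap.rTensor_comp]
  simp

section TensorCorep

variable {V W : Type*} [AddCommGroup V] [Module ℂ V] [AddCommGroup W] [Module ℂ W]

/-- The coaction `v ⊗ w ↦ v₀ ⊗ w₀ ⊗ v₁ w₁` on a tensor product. -/
def tensorδ (δ : V →ₗ[ℂ] V ⊗[ℂ] A) (δ' : W →ₗ[ℂ] W ⊗[ℂ] A) :
    V ⊗[ℂ] W →ₗ[ℂ] (V ⊗[ℂ] W) ⊗[ℂ] A :=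
  mulShuffle A V W ∘ₗ TensorProduct.map δ δ'

lemma tensorδ_tmul (δ : V →ₗ[ℂ] V ⊗[ℂ] A) (δ' : W →ₗ[ℂ] W ⊗[ℂ] A) (v : V) (w : W) :
    tensorδ δ δ' (v ⊗ₜ w) = mulShuffle A V W (δ v ⊗ₜ δ' w) := rfl

lemma assoc_mulShuffle (s : V ⊗[ℂ] A) (t : W ⊗[ℂ] A) (a b : A) :
    TensorProduct.assoc ℂ (V ⊗[ℂ] W) A A (mulShuffle A V W (s ⊗ₜ t) ⊗ₜ (a * b)) =
    mulShuffle (A ⊗[ℂ] A) V W (TensorProduct.assoc ℂ V A A (s ⊗ₜ a) ⊗ₜ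
      TensorProduct.assoc ℂ W A A (t ⊗ₜ b)) := by
  induction s using TensorProduct.induction_on with
  | zero => simp
  | add s s' h h' => simp only [TensorProduct.add_tmul, map_add, h, h']
  | tmul v p =>
    induction t using TensorProduct.induction_on with
    | zero => simp
    | add s s' h h' => simp only [TensorProduct.add_tmul, TensorProduct.tmul_add, map_add, h, h']
    | tmul w q => simp

lemma tensorδ_coassoc (δ : V →ₗ[ℂ] V ⊗[ℂ] A) (δ' : W →ₗ[ℂ] W ⊗[ℂ] A)
    (h : (TensorProduct.assoc ℂ V A A).toLinearMap ∘ₗ δ.rTensor A ∘ₗ δ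
      = (Coalgebra.comul (R := ℂ) (A := A)).lTensor V ∘ₗ δ)
    (h' : (TensorProduct.assoc ℂ W A A).toLinearMap ∘ₗ δ'.rTensor A ∘ₗ δ'
      = (Coalgebra.comul (R := ℂ) (A := A)).lTensor W ∘ₗ δ') :
    (TensorProduct.assoc ℂ (V ⊗[ℂ] W) A A).toLinearMap ∘ₗ (tensorδ δ δ').rTensor A ∘ₗ tensorδ δ δ'
      = (Coalgebra.comul (R := ℂ) (A := A)).lTensor (V ⊗[ℂ] W) ∘ₗ tensorδ δ δ' := by
  have L1 : (TensorProduct.assoc ℂ (V ⊗[ℂ] W) A A).toLinearMap ∘ₗ (tensorδ δ δ').rTensor A ∘ₗ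
      mulShuffle A V W = mulShuffle (A ⊗[ℂ] A) V W ∘ₗ TensorProduct.map
        ((TensorProduct.assoc ℂ V A A).toLinearMap ∘ₗ δ.rTensor A)
        ((TensorProduct.assoc ℂ W A A).toLinearMap ∘ₗ δ'.rTensor A) := by
    refine induction₂ fun v p w q => ?_
    simp only [LinearMap.comp_apply, mulShuffle_tmul, LinearMap.rTensor_tmul, tensorδ_tmul,
      LinearEquiv.coe_coe, assoc_mulShuffle, TensorProduct.map_tmul]
  have L2 : (Coalgebra.comul (R := ℂ) (A := A)).lTensor (V ⊗[ℂ] W) ∘ₗ mulShuffle A V W =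
      mulShuffle (A ⊗[ℂ] A) V W ∘ₗ TensorProduct.map
        ((Coalgebra.comul (R := ℂ) (A := A)).lTensor V)
        ((Coalgebra.comul (R := ℂ) (A := A)).lTensor W) := by
    refine induction₂ fun v p w q => ?_
    simp only [LinearMap.comp_apply, mulShuffle_tmul, LinearMap.lTensor_tmul,
      TensorProduct.map_tmul, Bialgebra.comul_mul]
  have e1 : (TensorProduct.assoc ℂ (V ⊗[ℂ] W) A A).toLinearMap ∘ₗ (tensorδ δ δ').rTensor A ∘ₗ
      tensorδ δ δ' = ((TensorProduct.assoc ℂ (V ⊗[ℂ] W) A A).toLinearMap ∘ₗ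
        (tensorδ δ δ').rTensor A ∘ₗ mulShuffle A V W) ∘ₗ TensorProduct.map δ δ' := rfl
  have e2 : (Coalgebra.comul (R := ℂ) (A := A)).lTensor (V ⊗[ℂ] W) ∘ₗ tensorδ δ δ' =
      ((Coalgebra.comul (R := ℂ) (A := A)).lTensor (V ⊗[ℂ] W) ∘ₗ mulShuffle A V W) ∘ₗ
        TensorProduct.map δ δ' := rfl
  rw [e1, e2, L1, L2, LinearMap.comp_assoc, LinearMap.comp_assoc, ← TensorProduct.map_comp,
    ← TensorProduct.map_comp, LinearMap.comp_assoc, LinearMap.comp_assoc, h, h']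

lemma tensorδ_counit (δ : V →ₗ[ℂ] V ⊗[ℂ] A) (δ' : W →ₗ[ℂ] W ⊗[ℂ] A)
    (h : (TensorProduct.rid ℂ V).toLinearMap ∘ₗ
      (Coalgebra.counit (R := ℂ) (A := A)).lTensor V ∘ₗ δ = LinearMap.id)
    (h' : (TensorProduct.rid ℂ W).toLinearMap ∘ₗ
      (Coalgebra.counit (R := ℂ) (A := A)).lTensor W ∘ₗ δ' = LinearMap.id) :
    (TensorProduct.rid ℂ (V ⊗[ℂ] W)).toLinearMap ∘ₗ
      (Coalgebra.counit (R := ℂ) (A := A)).lTensor (V ⊗[ℂ] W) ∘ₗ tensorδ δ δ' = LinearMap.id := by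
  have L : (TensorProduct.rid ℂ (V ⊗[ℂ] W)).toLinearMap ∘ₗ
      (Coalgebra.counit (R := ℂ) (A := A)).lTensor (V ⊗[ℂ] W) ∘ₗ mulShuffle A V W =
      TensorProduct.map
        ((TensorProduct.rid ℂ V).toLinearMap ∘ₗ (Coalgebra.counit (R := ℂ) (A := A)).lTensor V)
        ((TensorProduct.rid ℂ W).toLinearMap ∘ₗ
          (Coalgebra.counit (R := ℂ) (A := A)).lTensor W) := by
    refine induction₂ fun v p w q => ?_
    simp only [LinearMap.comp_apply, mulShuffle_tmul, LinearMap.lTensor_tmul, LinearEquiv.coe_coe,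
      TensorProduct.rid_tmul, TensorProduct.map_tmul, Bialgebra.counit_mul,
      TensorProduct.smul_tmul_smul]
  have e : (TensorProduct.rid ℂ (V ⊗[ℂ] W)).toLinearMap ∘ₗ
      (Coalgebra.counit (R := ℂ) (A := A)).lTensor (V ⊗[ℂ] W) ∘ₗ tensorδ δ δ' =
      ((TensorProduct.rid ℂ (V ⊗[ℂ] W)).toLinearMap ∘ₗ
      (Coalgebra.counit (R := ℂ) (A := A)).lTensor (V ⊗[ℂ] W) ∘ₗ mulShuffle A V W) ∘ₗ
        TensorProduct.map δ δ' := rfl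
  rw [e, L, ← TensorProduct.map_comp, LinearMap.comp_assoc, LinearMap.comp_assoc, h, h',
    TensorProduct.map_id]

lemma tensorδ_map {V' W' : Type*} [AddCommGroup V'] [Module ℂ V'] [AddCommGroup W'] [Module ℂ W']
    (δ : V →ₗ[ℂ] V ⊗[ℂ] A) (δ' : W →ₗ[ℂ] W ⊗[ℂ] A)
    (γ : V' →ₗ[ℂ] V' ⊗[ℂ] A) (γ' : W' →ₗ[ℂ] W' ⊗[ℂ] A) (f : V →ₗ[ℂ] V') (g : W →ₗ[ℂ] W')
    (hf : γ ∘ₗ f = f.rTensor A ∘ₗ δ) (hg : γ' ∘ₗ g = g.rTensor A ∘ₗ δ') :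
    tensorδ γ γ' ∘ₗ TensorProduct.map f g = (TensorProduct.map f g).rTensor A ∘ₗ tensorδ δ δ' := by
  have L : mulShuffle A V' W' ∘ₗ TensorProduct.map (f.rTensor A) (g.rTensor A) =
      (TensorProduct.map f g).rTensor A ∘ₗ mulShuffle A V W := by
    refine induction₂ fun v p w q => ?_
    simp
  rw [tensorδ, tensorδ, LinearMap.comp_assoc, ← TensorProduct.map_comp, hf, hg,
    TensorProduct.map_comp, ← LinearMap.comp_assoc, L, LinearMap.comp_assoc]

lemma tensorδ_assoc {U : Type*} [AddCommGroup U] [Module ℂ U]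
    (δ : V →ₗ[ℂ] V ⊗[ℂ] A) (δ' : W →ₗ[ℂ] W ⊗[ℂ] A) (δ'' : U →ₗ[ℂ] U ⊗[ℂ] A) :
    tensorδ δ (tensorδ δ' δ'') ∘ₗ (TensorProduct.assoc ℂ V W U).toLinearMap =
      (TensorProduct.assoc ℂ V W U).toLinearMap.rTensor A ∘ₗ tensorδ (tensorδ δ δ') δ'' := by
  apply TensorProduct.ext_threefold
  intro v w u
  simp only [LinearMap.comp_apply, LinearEquiv.coe_coe, TensorProduct.assoc_tmul, tensorδ_tmul]
  generalize δ v = r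
  generalize δ' w = s
  generalize δ'' u = t
  induction r using TensorProduct.induction_on with
  | zero => simp
  | add s s' h h' => simp only [TensorProduct.add_tmul, map_add, h, h']
  | tmul v p =>
    induction s using TensorProduct.induction_on with
    | zero => simp
    | add s s' h h' => simp only [TensorProduct.add_tmul, TensorProduct.tmul_add, map_add, h, h']
    | tmul w q =>
      induction t using TensorProduct.induction_on with
      | zero => simp
      | add s s' h h' => simp only [TensorProduct.tmul_add, map_add, h, h']
      | tmul u o => simp [mul_assoc]

variable (A) in
/-- The coaction `z ↦ z ⊗ 1` on `ℂ`. -/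
def unitδ : ℂ →ₗ[ℂ] ℂ ⊗[ℂ] A := (TensorProduct.mk ℂ ℂ A).flip 1

@[simp] lemma unitδ_apply (z : ℂ) : unitδ A z = z ⊗ₜ 1 := rfl

lemma tensorδ_lid (δ : V →ₗ[ℂ] V ⊗[ℂ] A) :
    δ ∘ₗ (TensorProduct.lid ℂ V).toLinearMap =
      (TensorProduct.lid ℂ V).toLinearMap.rTensor A ∘ₗ tensorδ (unitδ A) δ := by
  apply TensorProduct.ext'
  intro z v
  simp only [LinearMap.comp_apply, LinearEquiv.coe_coe, TensorProduct.lid_tmul, tensorδ_tmul,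
    map_smul, unitδ_apply]
  generalize δ v = r
  induction r using TensorProduct.induction_on with
  | zero => simp
  | add s s' h h' => simp only [TensorProduct.tmul_add, map_add, smul_add, h, h']
  | tmul v p => simp [TensorProduct.smul_tmul']

lemma tensorδ_rid (δ : V →ₗ[ℂ] V ⊗[ℂ] A) :
    δ ∘ₗ (TensorProduct.rid ℂ V).toLinearMap =
      (TensorProduct.rid ℂ V).toLinearMap.rTensor A ∘ₗ tensorδ δ (unitδ A) := by
  apply TensorProduct.ext'
  intro v z
  simp only [LinearMap.comp_apply, LinearEquiv.coe_coe, TensorProduct.rid_tmul, tensorδ_tmul,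
    map_smul, unitδ_apply]
  generalize δ v = r
  induction r using TensorProduct.induction_on with
  | zero => simp
  | add s s' h h' => simp only [TensorProduct.add_tmul, map_add, smul_add, h, h']
  | tmul v p => simp [TensorProduct.smul_tmul']

lemma unitδ_coassoc : (TensorProduct.assoc ℂ ℂ A A).toLinearMap ∘ₗ (unitδ A).rTensor A ∘ₗ unitδ A
    = (Coalgebra.comul (R := ℂ) (A := A)).lTensor ℂ ∘ₗ unitδ A := by
  apply LinearMap.ext_ring
  simp [Algebra.TensorProduct.one_def]

lemma unitδ_counit : (TensorProduct.rid ℂ ℂ).toLinearMap ∘ₗ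
    (Coalgebra.counit (R := ℂ) (A := A)).lTensor ℂ ∘ₗ unitδ A = LinearMap.id := by
  apply LinearMap.ext_ring
  simp

lemma unitδ_unitary : coeffMatrix (OrthonormalBasis.singleton Unit ℂ) (unitδ A) ∈
    unitary (Matrix Unit Unit A) := by
  have : coeffMatrix (OrthonormalBasis.singleton Unit ℂ) (unitδ A) = 1 := by
    ext i j
    simp [coeffMatrix]
  rw [this]
  exact one_mem _

end TensorCorep

lemma tensorδ_unitary {V W : Type*} [NormedAddCommGroup V] [InnerProductSpace ℂ V]
    [NormedAddCommGroup W] [InnerProductSpace ℂ W] {ι κ : Type*} [Fintype ι] [Fintype κ]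
    [DecidableEq ι] [DecidableEq κ] (b : OrthonormalBasis ι ℂ V) (c : OrthonormalBasis κ ℂ W)
    (δ : V →ₗ[ℂ] V ⊗[ℂ] A) (δ' : W →ₗ[ℂ] W ⊗[ℂ] A)
    (h : coeffMatrix b δ ∈ unitary (Matrix ι ι A))
    (h' : coeffMatrix c δ' ∈ unitary (Matrix κ κ A)) :
    coeffMatrix (b.tensorProduct c) (tensorδ δ δ') ∈ unitary (Matrix (ι × κ) (ι × κ) A) := by
  have key : ∀ i k j l, coeffMatrix (b.tensorProduct c) (tensorδ δ δ') (i, k) (j, l) =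
      coeffMatrix b δ i j * coeffMatrix c δ' k l := by
    intro i k j l
    simp only [coeffMatrix, OrthonormalBasis.tensorProduct_apply, tensorδ_tmul]
    generalize δ (b j) = s
    generalize δ' (c l) = t
    induction s using TensorProduct.induction_on with
    | zero => simp
    | add s s' h h' => simp only [TensorProduct.add_tmul, map_add, add_mul, h, h']
    | tmul v p =>
      induction t using TensorProduct.induction_on with
      | zero => simp
      | add s s' h h' => simp only [TensorProduct.tmul_add, map_add, mul_add, h, h']
      | tmul w q =>
        simp only [mulShuffle_tmul, slice_tmul, TensorProduct.inner_tmul, smul_mul_smul_comm]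
  obtain ⟨h1, h2⟩ := Unitary.mem_iff.mp h
  obtain ⟨h1', h2'⟩ := Unitary.mem_iff.mp h'
  have e1 : ∀ i j, ∑ x, star (coeffMatrix b δ x i) * coeffMatrix b δ x j = if i = j then 1 else 0 :=
    fun i j => by simpa [Matrix.mul_apply, Matrix.one_apply] using congrFun (congrFun h1 i) j
  have e2 : ∀ i j, ∑ x, coeffMatrix b δ i x * star (coeffMatrix b δ j x) = if i = j then 1 else 0 :=
    fun i j => by simpa [Matrix.mul_apply, Matrix.one_apply] using congrFun (congrFun h2 i) j
  have e1' : ∀ i j, ∑ x, star (coeffMatrix c δ' x i) * coeffMatrix c δ' x j =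
      if i = j then 1 else 0 :=
    fun i j => by simpa [Matrix.mul_apply, Matrix.one_apply] using congrFun (congrFun h1' i) j
  have e2' : ∀ i j, ∑ x, coeffMatrix c δ' i x * star (coeffMatrix c δ' j x) =
      if i = j then 1 else 0 :=
    fun i j => by simpa [Matrix.mul_apply, Matrix.one_apply] using congrFun (congrFun h2' i) j
  rw [Unitary.mem_iff]
  constructor
  · ext ⟨i, k⟩ ⟨j, l⟩
    rw [Matrix.mul_apply, Fintype.sum_prod_type_right]
    simp only [Matrix.star_apply, key, star_mul]
    have : ∀ y x, star (coeffMatrix c δ' y k) * star (coeffMatrix b δ x i) *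
        (coeffMatrix b δ x j * coeffMatrix c δ' y l) = star (coeffMatrix c δ' y k) *
        (star (coeffMatrix b δ x i) * coeffMatrix b δ x j) * coeffMatrix c δ' y l :=
      fun _ _ => by simp only [mul_assoc]
    simp only [this, ← Finset.sum_mul, ← Finset.mul_sum, e1, Matrix.one_apply, Prod.mk.injEq]
    by_cases hij : i = j
    · simp [hij, e1']
    · simp [hij]
  · ext ⟨i, k⟩ ⟨j, l⟩
    rw [Matrix.mul_apply, Fintype.sum_prod_type]
    simp only [Matrix.star_apply, key, star_mul]
    have : ∀ x y, coeffMatrix b δ i x * coeffMatrix c δ' k y *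
        (star (coeffMatrix c δ' l y) * star (coeffMatrix b δ j x)) = coeffMatrix b δ i x *
        (coeffMatrix c δ' k y * star (coeffMatrix c δ' l y)) * star (coeffMatrix b δ j x) :=
      fun _ _ => by simp only [mul_assoc]
    simp only [this, ← Finset.sum_mul, ← Finset.mul_sum, e2', Matrix.one_apply, Prod.mk.injEq]
    by_cases hkl : k = l
    · simp [hkl, e2]
    · simp [hkl]

/-- The tensor product of unitary corepresentations. -/
def tensor (X Y : UCorep A) : UCorep A where
  V := X.V ⊗ Y.V
  δ := tensorδ X.δ Y.δ
  coassoc := tensorδ_coassoc _ _ X.coassoc Y.coassoc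
  counit := tensorδ_counit _ _ X.counit Y.counit
  isUnitary _ _ := coeffMatrix_unitary_of_basis _ _ _ (tensorδ_unitary (stdOrthonormalBasis ℂ X.V)
    (stdOrthonormalBasis ℂ Y.V) _ _ (X.isUnitary _ _) (Y.isUnitary _ _))

variable (A) in
/-- The trivial corepresentation. -/
def unit : UCorep A where
  V := 𝟙_ Hilb
  δ := unitδ A
  coassoc := unitδ_coassoc
  counit := unitδ_counit
  isUnitary _ b := coeffMatrix_unitary_of_basis _ b _ unitδ_unitary

instance : MonoidalCategoryStruct (UCorep A) where
  tensorObj X Y := tensor X Y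
  whiskerLeft X _ _ f := ⟨X.V ◁ f.hom, tensorδ_map _ _ _ _ _ _ (by simp) f.comm⟩
  whiskerRight f Y := ⟨f.hom ▷ Y.V, tensorδ_map _ _ _ _ _ _ f.comm (by simp)⟩
  tensorHom f g := ⟨f.hom ⊗ₘ g.hom, tensorδ_map _ _ _ _ _ _ f.comm g.comm⟩
  tensorUnit := unit A
  associator X Y Z :=
    { hom := ⟨(α_ X.V Y.V Z.V).hom, tensorδ_assoc _ _ _⟩
      inv := ⟨(α_ X.V Y.V Z.V).inv, inv_comm _ _ _ (tensorδ_assoc _ _ _)⟩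
      hom_inv_id := hom_ext (Iso.hom_inv_id _)
      inv_hom_id := hom_ext (Iso.inv_hom_id _) }
  leftUnitor X :=
    { hom := ⟨(λ_ X.V).hom, tensorδ_lid _⟩
      inv := ⟨(λ_ X.V).inv, inv_comm _ _ _ (tensorδ_lid _)⟩
      hom_inv_id := hom_ext (Iso.hom_inv_id _)
      inv_hom_id := hom_ext (Iso.inv_hom_id _) }
  rightUnitor X :=
    { hom := ⟨(ρ_ X.V).hom, tensorδ_rid _⟩
      inv := ⟨(ρ_ X.V).inv, inv_comm _ _ _ (tensorδ_rid _)⟩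
      hom_inv_id := hom_ext (Iso.hom_inv_id _)
      inv_hom_id := hom_ext (Iso.inv_hom_id _) }

@[simp] lemma tensorObj_V (X Y : UCorep A) : (X ⊗ Y : UCorep A).V = X.V ⊗ Y.V := rfl
@[simp] lemma tensorUnit_V : (𝟙_ (UCorep A)).V = 𝟙_ Hilb := rfl

instance : MonoidalCategory (UCorep A) where
  tensorHom_def _ _ := hom_ext (MonoidalCategory.tensorHom_def _ _)
  id_tensorHom_id _ _ := hom_ext (MonoidalCategory.id_tensorHom_id _ _)
  tensorHom_comp_tensorHom _ _ _ _ := hom_ext (MonoidalCategory.tensorHom_comp_tensorHom _ _ _ _)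
  whiskerLeft_id _ _ := hom_ext (MonoidalCategory.whiskerLeft_id _ _)
  id_whiskerRight _ _ := hom_ext (MonoidalCategory.id_whiskerRight _ _)
  associator_naturality _ _ _ := hom_ext (MonoidalCategory.associator_naturality _ _ _)
  leftUnitor_naturality _ := hom_ext (MonoidalCategory.leftUnitor_naturality _)
  rightUnitor_naturality _ := hom_ext (MonoidalCategory.rightUnitor_naturality _)
  pentagon _ _ _ _ := hom_ext (MonoidalCategory.pentagon _ _ _ _)
  triangle _ _ := hom_ext (MonoidalCategory.triangle _ _)

end UCorep

end Corep

/-! ### Fibre functors and unitary pseudonatural transformations -/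

section Fibre

variable {C : Type*} [Category C] [MonoidalCategory C] [DaggerCategory C] [Preadditive C]
  [Linear ℂ C]

variable (C) in
/-- A fibre functor: a faithful unitary `ℂ`-linear monoidal functor to Hilbert spaces. -/
structure FibreFunctor where
  F : C ⥤ Hilb
  [monoidal : F.Monoidal]
  [additive : F.Additive]
  [linear : F.Linear ℂ]
  [faithful : F.Faithful]
  map_dag : ∀ {X Y : C} (f : X ⟶ Y), F.map (dag f) = dag (F.map f)
  μ_unitary : ∀ X Y : C, IsUnitary (Functor.LaxMonoidal.μ F X Y)
  ε_unitary : IsUnitary (Functor.LaxMonoidal.ε F)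

namespace FibreFunctor

attribute [instance] FibreFunctor.monoidal FibreFunctor.additive FibreFunctor.linear
  FibreFunctor.faithful

/-- The multiplicator `μ_{X,Y} : F(X) ⊗ F(Y) → F(X ⊗ Y)`. -/
abbrev μ (U : FibreFunctor C) (X Y : C) : U.F.obj X ⊗ U.F.obj Y ⟶ U.F.obj (X ⊗ Y) :=
  Functor.LaxMonoidal.μ U.F X Y

/-- The unitor `υ : ℂ → F(1)`. -/
abbrev υ (U : FibreFunctor C) : 𝟙_ Hilb ⟶ U.F.obj (𝟙_ C) := Functor.LaxMonoidal.ε U.F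

lemma dag_μ (U : FibreFunctor C) (X Y : C) :
    dag (U.μ X Y) = Functor.OplaxMonoidal.δ U.F X Y := by
  rw [← cancel_epi (U.μ X Y), (U.μ_unitary X Y).1, Functor.Monoidal.μ_δ]

/-- The image `[U(A), U(m) ∘ μ_{A,A}, U(u) ∘ υ]` of a Frobenius algebra under a fibre functor. -/
def mapFrob (U : FibreFunctor C) (A : FrobAlg C) : FrobAlg Hilb :=
  letI : MonObj (U.F.obj A.X) := U.F.monObjObj A.X
  { X := U.F.obj A.X
    frob_left := by
      change dag (U.μ A.X A.X ≫ U.F.map A.m) ▷ U.F.obj A.X ≫ _ ≫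
        U.F.obj A.X ◁ (U.μ A.X A.X ≫ U.F.map A.m) =
        (U.μ A.X A.X ≫ U.F.map A.m) ≫ dag (U.μ A.X A.X ≫ U.F.map A.m)
      have h := congrArg (fun f => U.μ A.X A.X ≫ U.F.map f ≫ dag (U.μ A.X A.X)) A.frob_left
      simp only [Functor.map_comp, Functor.Monoidal.map_whiskerRight, U.dag_μ,
        Functor.Monoidal.map_whiskerLeft, Functor.Monoidal.map_associator] at h
      simp only [dag_comp, ← U.map_dag, U.dag_μ]
      simpa only [Category.assoc, comp_whiskerRight, MonoidalCategory.whiskerLeft_comp,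
        Functor.Monoidal.μ_δ_assoc, Functor.Monoidal.μ_δ, Category.comp_id] using h
    frob_right := by
      change U.F.obj A.X ◁ dag (U.μ A.X A.X ≫ U.F.map A.m) ≫ _ ≫
        (U.μ A.X A.X ≫ U.F.map A.m) ▷ U.F.obj A.X =
        (U.μ A.X A.X ≫ U.F.map A.m) ≫ dag (U.μ A.X A.X ≫ U.F.map A.m)
      have h := congrArg (fun f => U.μ A.X A.X ≫ U.F.map f ≫ dag (U.μ A.X A.X)) A.frob_right
      simp only [Functor.map_comp, Functor.Monoidal.map_whiskerRight, U.dag_μ,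
        Functor.Monoidal.map_whiskerLeft, Functor.Monoidal.map_associator_inv] at h
      simp only [dag_comp, ← U.map_dag, U.dag_μ]
      simpa only [Category.assoc, comp_whiskerRight, MonoidalCategory.whiskerLeft_comp,
        Functor.Monoidal.μ_δ_assoc, Functor.Monoidal.μ_δ, Category.comp_id] using h }

end FibreFunctor

/-- A unitary pseudonatural transformation `(α, H) : F₁ → F₂` between fibre functors. -/
structure UPT (F₁ F₂ : FibreFunctor C) where
  H : Hilb
  comp : ∀ X : C, F₁.F.obj X ⊗ H ⟶ H ⊗ F₂.F.obj X
  isUnitary : ∀ X : C, IsUnitary (comp X)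
  naturality : ∀ {X Y : C} (f : X ⟶ Y),
    F₁.F.map f ▷ H ≫ comp Y = comp X ≫ H ◁ F₂.F.map f
  monoidality : ∀ X Y : C,
    F₁.μ X Y ▷ H ≫ comp (X ⊗ Y) =
      (α_ (F₁.F.obj X) (F₁.F.obj Y) H).hom ≫ F₁.F.obj X ◁ comp Y ≫
        (α_ (F₁.F.obj X) H (F₂.F.obj Y)).inv ≫ comp X ▷ F₂.F.obj Y ≫
          (α_ H (F₂.F.obj X) (F₂.F.obj Y)).hom ≫ H ◁ F₂.μ X Y
  unitality : F₁.υ ▷ H ≫ comp (𝟙_ C) = (λ_ H).hom ≫ (ρ_ H).inv ≫ H ◁ F₂.υ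

end Fibre

/-- The canonical fibre functor on `Rep(G)`. -/
def canonicalFibre (A : Type*) [Ring A] [HopfAlgebra ℂ A] [StarRing A] [StarModule ℂ A] :
    FibreFunctor (UCorep A) :=
  letI F : UCorep A ⥤ Hilb := { obj := fun X => X.V, map := fun f => f.hom }
  letI : F.Monoidal := Functor.CoreMonoidal.toMonoidal
    { εIso := Iso.refl _
      μIso := fun X Y => Iso.refl (X.V ⊗ Y.V)
      μIso_hom_natural_left := fun f X' => (Category.comp_id _).trans (Category.id_comp _).symm
      μIso_hom_natural_right := fun X' f => (Category.comp_id _).trans (Category.id_comp _).symm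
      associativity := fun X Y Z => by
        change (𝟙 (X.V ⊗ Y.V)) ▷ Z.V ≫ 𝟙 ((X.V ⊗ Y.V) ⊗ Z.V) ≫ (α_ X.V Y.V Z.V).hom =
          (α_ X.V Y.V Z.V).hom ≫ X.V ◁ 𝟙 (Y.V ⊗ Z.V) ≫ 𝟙 (X.V ⊗ Y.V ⊗ Z.V)
        simp
      left_unitality := fun X => by
        change (λ_ X.V).hom = 𝟙 (𝟙_ Hilb) ▷ X.V ≫ 𝟙 (𝟙_ Hilb ⊗ X.V) ≫ (λ_ X.V).hom
        simp
      right_unitality := fun X => by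
        change (ρ_ X.V).hom = X.V ◁ 𝟙 (𝟙_ Hilb) ≫ 𝟙 (X.V ⊗ 𝟙_ Hilb) ≫ (ρ_ X.V).hom
        simp }
  { F := F
    additive := ⟨rfl⟩
    linear := ⟨fun _ _ => rfl⟩
    faithful := ⟨fun h => UCorep.hom_ext h⟩
    map_dag := fun _ => rfl
    μ_unitary := fun X Y => isUnitary_id (X.V ⊗ Y.V)
    ε_unitary := isUnitary_id (𝟙_ Hilb) }

/-! ### Tensor products of Frobenius algebras, and the algebra of operators -/

namespace Hilb

lemma tensorμ_tmul {V W U Z : Hilb} (v : V) (w : W) (u : U) (z : Z) :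
    (tensorμ V W U Z).lin ((v ⊗ₜ[ℂ] w) ⊗ₜ[ℂ] (u ⊗ₜ[ℂ] z)) = (v ⊗ₜ[ℂ] u) ⊗ₜ[ℂ] (w ⊗ₜ[ℂ] z) := by
  simp [tensorμ]

lemma dag_tensorμ_tmul {V W U Z : Hilb} (v : V) (w : W) (u : U) (z : Z) :
    (dag (tensorμ V W U Z)).lin ((v ⊗ₜ[ℂ] u) ⊗ₜ[ℂ] (w ⊗ₜ[ℂ] z)) =
      (v ⊗ₜ[ℂ] w) ⊗ₜ[ℂ] (u ⊗ₜ[ℂ] z) := by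
  simp only [tensorμ, dag_comp, dag_associator_hom, dag_associator_inv, dag_braiding_hom,
    dag_whiskerLeft, dag_whiskerRight]
  simp [-dag_lin]

section TensorFrob

variable {V W : Hilb} (f : V ⊗ V ⟶ V) (g : W ⊗ W ⟶ W)

lemma frob_left_tensor (s : V ⊗[ℂ] V) (t : W ⊗[ℂ] W) (v : V) (w : W) :
    ((α_ (V ⊗ W) (V ⊗ W) (V ⊗ W)).hom ≫ (V ⊗ W) ◁ (tensorμ V W V W ≫ (f ⊗ₘ g))).lin
        ((dag (tensorμ V W V W)).lin (s ⊗ₜ[ℂ] t) ⊗ₜ[ℂ] (v ⊗ₜ[ℂ] w)) =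
      (dag (tensorμ V W V W)).lin (((α_ V V V).hom ≫ V ◁ f).lin (s ⊗ₜ[ℂ] v) ⊗ₜ[ℂ]
        ((α_ W W W).hom ≫ W ◁ g).lin (t ⊗ₜ[ℂ] w)) := by
  induction s using TensorProduct.induction_on with
  | zero => simp only [TensorProduct.zero_tmul, map_zero]
  | add s s' h h' => simp only [TensorProduct.add_tmul, map_add, h, h']
  | tmul v₁ v₂ =>
    induction t using TensorProduct.induction_on with
    | zero => simp only [TensorProduct.zero_tmul, TensorProduct.tmul_zero, map_zero]
    | add s s' h h' => simp only [TensorProduct.add_tmul, TensorProduct.tmul_add, map_add, h, h']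
    | tmul w₁ w₂ =>
      rw [dag_tensorμ_tmul]
      change (v₁ ⊗ₜ[ℂ] w₁) ⊗ₜ[ℂ] (TensorProduct.map f.lin g.lin)
          ((tensorμ V W V W).lin ((v₂ ⊗ₜ[ℂ] w₂) ⊗ₜ[ℂ] (v ⊗ₜ[ℂ] w))) =
        (dag (tensorμ V W V W)).lin
          ((v₁ ⊗ₜ[ℂ] f.lin (v₂ ⊗ₜ[ℂ] v)) ⊗ₜ[ℂ] (w₁ ⊗ₜ[ℂ] g.lin (w₂ ⊗ₜ[ℂ] w)))
      rw [tensorμ_tmul, dag_tensorμ_tmul]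
      rfl

lemma frob_right_tensor (s : V ⊗[ℂ] V) (t : W ⊗[ℂ] W) (v : V) (w : W) :
    ((α_ (V ⊗ W) (V ⊗ W) (V ⊗ W)).inv ≫ (tensorμ V W V W ≫ (f ⊗ₘ g)) ▷ (V ⊗ W)).lin
        ((v ⊗ₜ[ℂ] w) ⊗ₜ[ℂ] (dag (tensorμ V W V W)).lin (s ⊗ₜ[ℂ] t)) =
      (dag (tensorμ V W V W)).lin (((α_ V V V).inv ≫ f ▷ V).lin (v ⊗ₜ[ℂ] s) ⊗ₜ[ℂ]
        ((α_ W W W).inv ≫ g ▷ W).lin (w ⊗ₜ[ℂ] t)) := by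
  induction s using TensorProduct.induction_on with
  | zero => simp only [TensorProduct.zero_tmul, TensorProduct.tmul_zero, map_zero]
  | add s s' h h' => simp only [TensorProduct.add_tmul, TensorProduct.tmul_add, map_add, h, h']
  | tmul v₁ v₂ =>
    induction t using TensorProduct.induction_on with
    | zero => simp only [TensorProduct.tmul_zero, map_zero]
    | add s s' h h' => simp only [TensorProduct.tmul_add, map_add, h, h']
    | tmul w₁ w₂ =>
      rw [dag_tensorμ_tmul]
      change (TensorProduct.map f.lin g.lin)
          ((tensorμ V W V W).lin ((v ⊗ₜ[ℂ] w) ⊗ₜ[ℂ] (v₁ ⊗ₜ[ℂ] w₁))) ⊗ₜ[ℂ] (v₂ ⊗ₜ[ℂ] w₂) =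
        (dag (tensorμ V W V W)).lin
          ((f.lin (v ⊗ₜ[ℂ] v₁) ⊗ₜ[ℂ] v₂) ⊗ₜ[ℂ] (g.lin (w ⊗ₜ[ℂ] w₁) ⊗ₜ[ℂ] w₂))
      rw [tensorμ_tmul, dag_tensorμ_tmul]
      rfl

end TensorFrob

/-- The tensor product of Frobenius algebras in the category of Hilbert spaces. -/
def tensorFrob (A B : FrobAlg Hilb) : FrobAlg Hilb where
  X := A.X ⊗ B.X
  frob_left := by
    change dag (tensorμ A.X B.X A.X B.X ≫ (A.m ⊗ₘ B.m)) ▷ (A.X ⊗ B.X) ≫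
      (α_ _ _ _).hom ≫ (A.X ⊗ B.X) ◁ (tensorμ A.X B.X A.X B.X ≫ (A.m ⊗ₘ B.m)) =
      (tensorμ A.X B.X A.X B.X ≫ (A.m ⊗ₘ B.m)) ≫ dag (tensorμ A.X B.X A.X B.X ≫ (A.m ⊗ₘ B.m))
    apply hom_ext
    refine induction₂ fun v w v' w' => ?_
    have h1 := LinearMap.congr_fun (congrArg Hom.lin A.frob_left) (v ⊗ₜ[ℂ] v')
    have h2 := LinearMap.congr_fun (congrArg Hom.lin B.frob_left) (w ⊗ₜ[ℂ] w')
    rw [dag_comp, dag_tensorHom, comp_lin, LinearMap.comp_apply]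
    refine (frob_left_tensor A.m B.m ((dag A.m).lin v) ((dag B.m).lin w) v' w').trans ?_
    refine (congrArg₂ (fun s t => (dag (tensorμ A.X B.X A.X B.X)).lin (s ⊗ₜ[ℂ] t)) h1 h2).trans ?_
    simp only [comp_lin, LinearMap.comp_apply]
    erw [tensorμ_tmul]
    rfl
  frob_right := by
    change (A.X ⊗ B.X) ◁ dag (tensorμ A.X B.X A.X B.X ≫ (A.m ⊗ₘ B.m)) ≫
      (α_ _ _ _).inv ≫ (tensorμ A.X B.X A.X B.X ≫ (A.m ⊗ₘ B.m)) ▷ (A.X ⊗ B.X) =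
      (tensorμ A.X B.X A.X B.X ≫ (A.m ⊗ₘ B.m)) ≫ dag (tensorμ A.X B.X A.X B.X ≫ (A.m ⊗ₘ B.m))
    apply hom_ext
    refine induction₂ fun v w v' w' => ?_
    have h1 := LinearMap.congr_fun (congrArg Hom.lin A.frob_right) (v ⊗ₜ[ℂ] v')
    have h2 := LinearMap.congr_fun (congrArg Hom.lin B.frob_right) (w ⊗ₜ[ℂ] w')
    rw [dag_comp, dag_tensorHom, comp_lin, LinearMap.comp_apply]
    refine (frob_right_tensor A.m B.m ((dag A.m).lin v') ((dag B.m).lin w') v w).trans ?_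
    refine (congrArg₂ (fun s t => (dag (tensorμ A.X B.X A.X B.X)).lin (s ⊗ₜ[ℂ] t)) h1 h2).trans ?_
    simp only [comp_lin, LinearMap.comp_apply]
    erw [tensorμ_tmul]
    rfl

variable {H : Hilb} {ι : Type} [Fintype ι]

/-- The cap `|i⟩ ⊗ |j⟩ ↦ δ_ij` defined by an orthonormal basis. -/
def cap (b : OrthonormalBasis ι ℂ H) : H ⊗ H ⟶ 𝟙_ Hilb :=
  ⟨∑ i, LinearMap.mul' ℂ ℂ ∘ₗ TensorProduct.map (innerₛₗ ℂ (b i)) (innerₛₗ ℂ (b i))⟩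

/-- The cup `1 ↦ ∑ |i⟩ ⊗ |i⟩` defined by an orthonormal basis. -/
def cup (b : OrthonormalBasis ι ℂ H) : 𝟙_ Hilb ⟶ H ⊗ H :=
  ⟨LinearMap.toSpanSingleton ℂ (H ⊗[ℂ] H) (∑ i, b i ⊗ₜ[ℂ] b i)⟩

variable (H) in
/-- The scalar `√(dim H)`. -/
def sqrtDim : ℂ := (Real.sqrt (Module.finrank ℂ H) : ℂ)

/-- The multiplication `(1/√d) (id ⊗ cap ⊗ id)` on `H ⊗ H`. -/
def boundedMul (b : OrthonormalBasis ι ℂ H) : (H ⊗ H) ⊗ (H ⊗ H) ⟶ H ⊗ H :=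
  (sqrtDim H)⁻¹ • ((α_ H H (H ⊗ H)).hom ≫ H ◁ ((α_ H H H).inv ≫ cap b ▷ H ≫ (λ_ H).hom))

/-- The value of the cap on a pure tensor. -/
def capVal (b : OrthonormalBasis ι ℂ H) (x y : H) : ℂ := ∑ i, inner ℂ (b i) x * inner ℂ (b i) y

lemma cap_tmul (b : OrthonormalBasis ι ℂ H) (x y : H) :
    (cap b).lin (x ⊗ₜ[ℂ] y) = capVal b x y := by
  change (∑ i, LinearMap.mul' ℂ ℂ ∘ₗ
    TensorProduct.map (innerₛₗ ℂ (b i)) (innerₛₗ ℂ (b i))) (x ⊗ₜ[ℂ] y) = _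
  simp [capVal, LinearMap.sum_apply]

lemma boundedMul_tmul (b : OrthonormalBasis ι ℂ H) (x y z w : H) :
    (boundedMul b).lin ((x ⊗ₜ[ℂ] y) ⊗ₜ[ℂ] (z ⊗ₜ[ℂ] w)) =
      ((sqrtDim H)⁻¹ * capVal b y z) • (x ⊗ₜ[ℂ] w) := by
  have : ((α_ H H (H ⊗ H)).hom ≫ H ◁ ((α_ H H H).inv ≫ cap b ▷ H ≫ (λ_ H).hom)).lin
      ((x ⊗ₜ[ℂ] y) ⊗ₜ[ℂ] (z ⊗ₜ[ℂ] w)) =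
      x ⊗ₜ[ℂ] (TensorProduct.lid ℂ H) ((cap b).lin (y ⊗ₜ[ℂ] z) ⊗ₜ[ℂ] w) := rfl
  rw [boundedMul, smul_lin, LinearMap.smul_apply, this, cap_tmul, TensorProduct.lid_tmul,
    TensorProduct.tmul_smul, mul_smul]

lemma star_sqrtDim : (starRingEnd ℂ) (sqrtDim H)⁻¹ = (sqrtDim H)⁻¹ := by
  simp [sqrtDim]

lemma inner_aux {V : Type*} [NormedAddCommGroup V] [InnerProductSpace ℂ V]
    (b : OrthonormalBasis ι ℂ V) (c : ℂ) (hc : (starRingEnd ℂ) c = c) (x w p q r s : V) :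
    inner ℂ (x ⊗ₜ[ℂ] w) ((c * ∑ i, inner ℂ (b i) q * inner ℂ (b i) r) • (p ⊗ₜ[ℂ] s)) =
      inner ℂ (c • ∑ i, (x ⊗ₜ[ℂ] b i) ⊗ₜ[ℂ] (b i ⊗ₜ[ℂ] w)) ((p ⊗ₜ[ℂ] q) ⊗ₜ[ℂ] (r ⊗ₜ[ℂ] s)) := by
  have h1 : ∀ (a : ℂ) (u v : V ⊗[ℂ] V), inner ℂ u (a • v) = a * inner ℂ u v :=
    fun a u v => inner_smul_right u v a
  have h2 : ∀ (a : ℂ) (u v : (V ⊗[ℂ] V) ⊗[ℂ] (V ⊗[ℂ] V)),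
      inner ℂ (a • u) v = (starRingEnd ℂ) a * inner ℂ u v :=
    fun a u v => inner_smul_left u v a
  have h3 : ∀ (u : ι → (V ⊗[ℂ] V) ⊗[ℂ] (V ⊗[ℂ] V)) (v : (V ⊗[ℂ] V) ⊗[ℂ] (V ⊗[ℂ] V)),
      inner ℂ (∑ i, u i) v = ∑ i, inner ℂ (u i) v :=
    fun u v => sum_inner (𝕜 := ℂ) Finset.univ u v
  rw [h1, h2, h3, hc]
  simp only [TensorProduct.inner_tmul]
  rw [mul_assoc, Finset.sum_mul]
  congr 1
  refine Finset.sum_congr rfl fun i _ => ?_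
  ring

lemma dag_boundedMul_tmul (b : OrthonormalBasis ι ℂ H) (x w : H) :
    (dag (boundedMul b)).lin (x ⊗ₜ[ℂ] w) =
      (sqrtDim H)⁻¹ • ∑ i, (x ⊗ₜ[ℂ] b i) ⊗ₜ[ℂ] (b i ⊗ₜ[ℂ] w) := by
  have key : innerₛₗ ℂ (x ⊗ₜ[ℂ] w) ∘ₗ (boundedMul b).lin =
      innerₛₗ ℂ ((sqrtDim H)⁻¹ • ∑ i, (x ⊗ₜ[ℂ] b i) ⊗ₜ[ℂ] (b i ⊗ₜ[ℂ] w)) := by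
    refine induction₂ fun p q r s => ?_
    rw [LinearMap.comp_apply, boundedMul_tmul]
    exact inner_aux b _ star_sqrtDim x w p q r s
  refine ext_inner_right ℂ fun t => ?_
  rw [dag_lin, LinearMap.adjoint_inner_left]
  exact LinearMap.congr_fun key t

lemma capVal_left (b : OrthonormalBasis ι ℂ H) (x : H) : ∑ i, capVal b x (b i) • b i = x := by
  classical
  conv_rhs => rw [← b.sum_repr' x]
  refine Finset.sum_congr rfl fun i _ => ?_
  simp [capVal, orthonormal_iff_ite.mp b.orthonormal]

lemma capVal_right (b : OrthonormalBasis ι ℂ H) (x : H) : ∑ i, capVal b (b i) x • b i = x := by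
  classical
  conv_rhs => rw [← b.sum_repr' x]
  refine Finset.sum_congr rfl fun i _ => ?_
  simp [capVal, orthonormal_iff_ite.mp b.orthonormal]

lemma sqrtDim_smul (x : H) : (sqrtDim H * (sqrtDim H)⁻¹) • x = x := by
  by_cases h : Module.finrank ℂ H = 0
  · have : Subsingleton H := Module.finrank_zero_iff.mp h
    exact Subsingleton.elim _ _
  · have : sqrtDim H ≠ 0 := by
      simpa [sqrtDim, Complex.ofReal_eq_zero, Real.sqrt_eq_zero'] using h
    rw [mul_inv_cancel₀ this, one_smul]

/-- The Frobenius algebra `B(H) ≅ H ⊗ H` with multiplication `(1/√d) (id ⊗ cap ⊗ id)` and unit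
`√d cup`; it corresponds to `B(H)` with the functional `d Tr`, where `|i⟩⟨j|` corresponds to
`√d |i⟩ ⊗ |j⟩`. -/
def bounded (b : OrthonormalBasis ι ℂ H) : FrobAlg Hilb where
  X := H ⊗ H
  mon :=
    { mul := boundedMul b
      one := sqrtDim H • cup b
      one_mul := by
        apply hom_ext
        refine TensorProduct.ext' fun (z : ℂ) (t : H ⊗[ℂ] H) => ?_
        change (boundedMul b).lin ((sqrtDim H • z • ∑ i, b i ⊗ₜ[ℂ] b i) ⊗ₜ[ℂ] t) = z • t
        induction t using TensorProduct.induction_on with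
        | zero => simp only [TensorProduct.tmul_zero, map_zero, smul_zero]
        | add s t hs ht => simp only [TensorProduct.tmul_add, map_add, smul_add, hs, ht]
        | tmul x w =>
          rw [smul_comm, ← TensorProduct.smul_tmul', map_smul]
          congr 1
          rw [← TensorProduct.smul_tmul', map_smul, TensorProduct.sum_tmul, map_sum]
          simp only [boundedMul_tmul, mul_smul]
          rw [← Finset.smul_sum, smul_smul]
          simp only [TensorProduct.smul_tmul']
          rw [← TensorProduct.sum_tmul, capVal_right, TensorProduct.smul_tmul', sqrtDim_smul]
      mul_one := by
        apply hom_ext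
        refine TensorProduct.ext' fun (t : H ⊗[ℂ] H) (z : ℂ) => ?_
        change (boundedMul b).lin (t ⊗ₜ[ℂ] (sqrtDim H • z • ∑ i, b i ⊗ₜ[ℂ] b i)) = z • t
        induction t using TensorProduct.induction_on with
        | zero => simp only [TensorProduct.zero_tmul, map_zero, smul_zero]
        | add s t hs ht => simp only [TensorProduct.add_tmul, map_add, smul_add, hs, ht]
        | tmul x w =>
          rw [smul_comm, TensorProduct.tmul_smul, map_smul]
          congr 1
          rw [TensorProduct.tmul_smul, map_smul, TensorProduct.tmul_sum, map_sum]
          simp only [boundedMul_tmul, mul_smul]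
          rw [← Finset.smul_sum, smul_smul]
          simp only [← TensorProduct.tmul_smul]
          rw [← TensorProduct.tmul_sum, capVal_left, ← TensorProduct.tmul_smul, sqrtDim_smul]
      mul_assoc := by
        apply hom_ext
        refine TensorProduct.ext_threefold fun r s t => ?_
        change (boundedMul b).lin ((boundedMul b).lin (r ⊗ₜ[ℂ] s) ⊗ₜ[ℂ] t) =
          (boundedMul b).lin (r ⊗ₜ[ℂ] (boundedMul b).lin (s ⊗ₜ[ℂ] t))
        induction r using TensorProduct.induction_on with
        | zero => simp only [TensorProduct.zero_tmul, map_zero]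
        | add s t hs ht => simp only [TensorProduct.add_tmul, map_add, hs, ht]
        | tmul x y =>
          induction s using TensorProduct.induction_on with
          | zero => simp only [TensorProduct.zero_tmul, TensorProduct.tmul_zero, map_zero]
          | add s t hs ht =>
            simp only [TensorProduct.add_tmul, TensorProduct.tmul_add, map_add, hs, ht]
          | tmul z w =>
            induction t using TensorProduct.induction_on with
            | zero => simp only [TensorProduct.tmul_zero, map_zero]
            | add s t hs ht => simp only [TensorProduct.tmul_add, map_add, hs, ht]
            | tmul p q =>
              rw [boundedMul_tmul, boundedMul_tmul, ← TensorProduct.smul_tmul',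
                TensorProduct.tmul_smul, map_smul, map_smul, boundedMul_tmul, boundedMul_tmul,
                smul_smul, smul_smul, mul_comm] }
  frob_left := by
    apply hom_ext
    refine induction₂ fun x y z w => ?_
    change ((α_ (H ⊗ H : Hilb) (H ⊗ H : Hilb) (H ⊗ H : Hilb)).hom ≫
        (H ⊗ H : Hilb) ◁ boundedMul b).lin
        ((dag (boundedMul b)).lin (x ⊗ₜ[ℂ] y) ⊗ₜ[ℂ] (z ⊗ₜ[ℂ] w)) =
      (dag (boundedMul b)).lin ((boundedMul b).lin ((x ⊗ₜ[ℂ] y) ⊗ₜ[ℂ] (z ⊗ₜ[ℂ] w)))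
    rw [boundedMul_tmul, map_smul, dag_boundedMul_tmul, dag_boundedMul_tmul,
      ← TensorProduct.smul_tmul', map_smul, TensorProduct.sum_tmul, map_sum, smul_smul,
      mul_comm, mul_smul, mul_smul, smul_comm]
    congr 1
    rw [Finset.smul_sum, Finset.smul_sum]
    refine Finset.sum_congr rfl fun i _ => ?_
    change (x ⊗ₜ[ℂ] b i) ⊗ₜ[ℂ] (boundedMul b).lin ((b i ⊗ₜ[ℂ] y) ⊗ₜ[ℂ] (z ⊗ₜ[ℂ] w)) = _
    rw [boundedMul_tmul, TensorProduct.tmul_smul, mul_smul]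
  frob_right := by
    apply hom_ext
    refine induction₂ fun x y z w => ?_
    change ((α_ (H ⊗ H : Hilb) (H ⊗ H : Hilb) (H ⊗ H : Hilb)).inv ≫
        boundedMul b ▷ (H ⊗ H : Hilb)).lin
        ((x ⊗ₜ[ℂ] y) ⊗ₜ[ℂ] (dag (boundedMul b)).lin (z ⊗ₜ[ℂ] w)) =
      (dag (boundedMul b)).lin ((boundedMul b).lin ((x ⊗ₜ[ℂ] y) ⊗ₜ[ℂ] (z ⊗ₜ[ℂ] w)))
    rw [boundedMul_tmul, map_smul, dag_boundedMul_tmul, dag_boundedMul_tmul,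
      TensorProduct.tmul_smul, map_smul, TensorProduct.tmul_sum, map_sum, smul_smul,
      mul_comm, mul_smul, mul_smul, smul_comm]
    congr 1
    rw [Finset.smul_sum, Finset.smul_sum]
    refine Finset.sum_congr rfl fun i _ => ?_
    change (boundedMul b).lin ((x ⊗ₜ[ℂ] y) ⊗ₜ[ℂ] (z ⊗ₜ[ℂ] b i)) ⊗ₜ[ℂ] (b i ⊗ₜ[ℂ] w) = _
    rw [boundedMul_tmul, ← TensorProduct.smul_tmul', mul_smul]

/-- The channel `Ψ : ℂ → B(H) ⊗ B(H)` which initialises the maximally entangled state; as an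
element, it is `(1/d²) ∑ (|i⟩ ⊗ |j⟩) ⊗ (|i⟩ ⊗ |j⟩)`. This is the operator `|ψ⟩⟨ψ|` for
`ψ = (1/√d) ∑ |i⟩ ⊗ |i⟩`, normalised for the functional `d Tr ⊗ d Tr`. -/
def maxEnt (b : OrthonormalBasis ι ℂ H) : 𝟙_ Hilb ⟶ (H ⊗ H) ⊗ (H ⊗ H) :=
  ((Module.finrank ℂ H : ℂ) ^ 2)⁻¹ •
    ((λ_ (𝟙_ Hilb)).inv ≫ (cup b ⊗ₘ cup b) ≫ tensorμ H H H H)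

/-- `(E, D, H)` is an entanglement-assisted channel coding scheme for `T : X → Y` from
`N : A → B`: encoding and decoding are channels, and
`D ∘ (N ⊗ id) ∘ (E ⊗ id) ∘ (id ⊗ Ψ) = T`. -/
structure IsCodingScheme (b : OrthonormalBasis ι ℂ H) {X Y A B : FrobAlg Hilb}
    (E : X.X ⊗ (H ⊗ H) ⟶ A.X) (D : B.X ⊗ (H ⊗ H) ⟶ Y.X)
    (T : X.X ⟶ Y.X) (N : A.X ⟶ B.X) : Prop where
  encoding : FrobAlg.IsChannel (tensorFrob X (bounded b)) A E
  decoding : FrobAlg.IsChannel (tensorFrob B (bounded b)) Y D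
  simulates : (ρ_ X.X).inv ≫ X.X ◁ maxEnt b ≫ (α_ X.X (H ⊗ H) (H ⊗ H)).inv ≫
    E ▷ (H ⊗ H) ≫ N ▷ (H ⊗ H) ≫ D = T

/-- For `γ : V ⊗ H → H ⊗ W`, the map `V ⊗ (H ⊗ H) → W` which moves the first copy of `H` to the
left of `V`, applies `γ` to `V` and the second copy of `H`, and caps off the two copies of `H`,
multiplied by `√d`. -/
def bend (b : OrthonormalBasis ι ℂ H) {V W : Hilb} (γ : V ⊗ H ⟶ H ⊗ W) : V ⊗ (H ⊗ H) ⟶ W :=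
  sqrtDim H • ((α_ V H H).inv ≫ (β_ V H).hom ▷ H ≫ (α_ H V H).hom ≫ H ◁ γ ≫
    (α_ H H W).inv ≫ cap b ▷ W ≫ (λ_ W).hom)

end Hilb

namespace UPT

open Hilb

variable {C : Type*} [Category C] [MonoidalCategory C] [DaggerCategory C] [Preadditive C]
  [Linear ℂ C] {F₁ F₂ : FibreFunctor C} (α : UPT F₁ F₂) {ι : Type} [Fintype ι]
  (b : OrthonormalBasis ι ℂ α.H)

/-- The components `F₂(X) ⊗ H → H ⊗ F₁(X)` of the dual of a unitary pseudonatural transformation: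
`α_X†` with its `H`-wires bent around. -/
def dualComp (X : C) : F₂.F.obj X ⊗ α.H ⟶ α.H ⊗ F₁.F.obj X :=
  (λ_ _).inv ≫ cup b ▷ (F₂.F.obj X ⊗ α.H) ≫ (α_ _ _ _).hom ≫
    α.H ◁ ((α_ _ _ _).inv ≫ dag (α.comp X) ▷ α.H ≫ (α_ _ _ _).hom ≫
      F₁.F.obj X ◁ cap b ≫ (ρ_ _).hom)

/-- `u_A : F₁(A) ⊗ B(H) → F₂(A)`. -/
def u (A : FrobAlg C) : F₁.F.obj A.X ⊗ (α.H ⊗ α.H) ⟶ F₂.F.obj A.X := bend b (α.comp A.X)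

/-- `v_A : F₂(A) ⊗ B(H) → F₁(A)`. -/
def v (A : FrobAlg C) : F₂.F.obj A.X ⊗ (α.H ⊗ α.H) ⟶ F₁.F.obj A.X := bend b (α.dualComp b A.X)

end UPT

end EntSym

end

noncomputable section

namespace EntSym

open DaggerCategory

/-! ### Additivity of tensor product and dagger on Hilbert spaces. -/

namespace Hilb

/-! Let P and Q be the images of a Frobenius algebra under the two fibre functors and d = dim H. In
an orthonormal basis of H, the component of the transformation at the algebra is a d × d matrix of
maps γ_jk : P → Q. Naturality at m, m†, u and u†, combined with monoidality and unitality, makes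
this matrix multiplicative, comultiplicative, unital and counital, where two factors are composed by
matrix multiplication of the indices. Unitarity gives ∑ γ_jk† γ_jk = d · id and ∑ γ_jk γ_jk† = d ·
id. All this is `UPT.unitaryMatrixHom`.

What remains is compatibility with the involution: γ_lk must be the conjugate of γ_kl under the
self-dualities of P and Q. `UnitaryMatrixHom.star_right` obtains it from an equality case of
Cauchy–Schwarz. Bending the two maps turns them into vectors of P ⊗ Q; summed over all indices, both
families have the same total squared norm, and this is also their total overlap, so they coincide.

Hence γ is a counit-preserving *-homomorphism from P to d × d matrices over Q. The Choi morphism of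
the encoding map has the form id_H ⊗ N, where N has blocks `choi (γ p j)`. Multiplicativity and
speciality make N idempotent (`choi_comp_choi`), the involution makes it self-adjoint (`dag_choi`),
so the Choi morphism is a projection and the map is completely positive (`MatrixStarHom.isChannel`).
The adjoint matrix γ_jk† satisfies the same axioms with P and Q exchanged, and it is the matrix of
the dual transformation, which handles the decoding map.

Feeding in the maximally entangled state yields (1/d) ∑ γ_jk† F'(f) γ_jk. Naturality moves f outside
the sum and unitarity turns the rest into d · id (`simulation_eq`, `UPT.isCodingScheme`); the other
direction is symmetric. That F(f) and F'(f) are channels follows by conjugating the CP condition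
with the unitary multiplicators. -/

instance : MonoidalPreadditive Hilb where
  whiskerLeft_zero := by intros; apply hom_ext; simp
  zero_whiskerRight := by intros; apply hom_ext; simp
  whiskerLeft_add _ _ := by apply hom_ext; simp [LinearMap.lTensor_add]
  add_whiskerRight _ _ := by apply hom_ext; simp [LinearMap.rTensor_add]

/-- The linear map underlying a morphism, as an additive map. -/
def linHom (V W : Hilb) : (V ⟶ W) →+ (V →ₗ[ℂ] W) where
  toFun f := f.lin
  map_zero' := rfl
  map_add' _ _ := rfl

lemma sum_lin {V W : Hilb} {κ : Type*} (s : Finset κ) (f : κ → (V ⟶ W)) :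
    (∑ i ∈ s, f i).lin = ∑ i ∈ s, (f i).lin :=
  map_sum (linHom V W) f s

lemma sum_lin_apply {V W : Hilb} {κ : Type*} (s : Finset κ) (f : κ → (V ⟶ W)) (x : V) :
    (∑ i ∈ s, f i).lin x = ∑ i ∈ s, (f i).lin x := by
  rw [sum_lin, LinearMap.sum_apply]

lemma dag_sum {V W : Hilb} {κ : Type*} (s : Finset κ) (f : κ → (V ⟶ W)) :
    dag (∑ i ∈ s, f i) = ∑ i ∈ s, dag (f i) := by
  apply hom_ext
  rw [dag_lin, sum_lin, sum_lin, map_sum]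
  rfl

lemma dag_zero {V W : Hilb} : dag (0 : V ⟶ W) = 0 := by
  apply hom_ext
  rw [dag_lin, zero_lin, zero_lin, map_zero]

/-! ### The Choi morphism of a map between Frobenius algebras -/

section Choi

variable {P Q : FrobAlg Hilb}

lemma comul_coassoc (P : FrobAlg Hilb) :
    dag P.m ≫ dag P.m ▷ P.X ≫ (α_ P.X P.X P.X).hom = dag P.m ≫ P.X ◁ dag P.m := by
  have h := congrArg dag (MonObj.mul_assoc P.X)
  simp only [dag_comp, dag_whiskerLeft, dag_whiskerRight, dag_associator_hom] at h
  rw [← cancel_mono (α_ P.X P.X P.X).inv]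
  simpa using h

/-- The Frobenius equation with the unit inserted in one leg. Together with its mirror image it
reduces statements about m† to statements about the cup, where the involution axiom can be applied.
-/
lemma comul_eq_cup_left (P : FrobAlg Hilb) :
    dag P.m = (λ_ P.X).inv ≫ P.cup ▷ P.X ≫ (α_ P.X P.X P.X).hom ≫ P.X ◁ P.m := by
  rw [FrobAlg.cup, comp_whiskerRight, Category.assoc, P.frob_left, MonObj.one_mul_assoc,
    Iso.inv_hom_id_assoc]

lemma comul_eq_cup_right (P : FrobAlg Hilb) :
    dag P.m = (ρ_ P.X).inv ≫ P.X ◁ P.cup ≫ (α_ P.X P.X P.X).inv ≫ P.m ▷ P.X := by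
  rw [FrobAlg.cup, MonoidalCategory.whiskerLeft_comp, Category.assoc, P.frob_right,
    MonObj.mul_one_assoc, Iso.inv_hom_id_assoc]

/-- The endomorphism `(id ⊗ m_Q) ∘ (id ⊗ h ⊗ id) ∘ (m_P† ⊗ id)` of `P ⊗ Q`. -/
def choi (h : P.X ⟶ Q.X) : P.X ⊗ Q.X ⟶ P.X ⊗ Q.X :=
  dag P.m ▷ Q.X ≫ (α_ P.X P.X Q.X).hom ≫ P.X ◁ (h ▷ Q.X ≫ Q.m)

lemma choi_sum {κ : Type*} (s : Finset κ) (h : κ → (P.X ⟶ Q.X)) :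
    choi (∑ i ∈ s, h i) = ∑ i ∈ s, choi (h i) := by
  simp only [choi, sum_whiskerRight, Preadditive.sum_comp, whiskerLeft_sum, Preadditive.comp_sum]

/-- Choi morphisms compose by convolution. -/
lemma choi_comp_choi (h k : P.X ⟶ Q.X) :
    choi h ≫ choi k = choi (dag P.m ≫ (k ⊗ₘ h) ≫ Q.m) := by
  have assocQ : Q.X ◁ Q.m ≫ Q.m = (α_ Q.X Q.X Q.X).inv ≫ Q.m ▷ Q.X ≫ Q.m := by
    rw [MonObj.mul_assoc]; simp
  have hc := comul_coassoc P
  -- In Sweedler notation `choi h` is x ⊗ y ↦ x₁ ⊗ h(x₂) y, so two applications give x₁ ⊗ k(x₂)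
  -- h(x₃) y. The map applied second stands on the left of the product, whence `k ⊗ₘ h`. The three
  -- stages are interchange, (co)associativity, and regrouping.
  calc choi h ≫ choi k
      = (dag P.m ≫ dag P.m ▷ P.X ≫ (α_ P.X P.X P.X).hom) ▷ Q.X ≫ (α_ _ _ _).hom ≫
          P.X ◁ ((α_ _ _ _).hom ≫ k ▷ (P.X ⊗ Q.X) ≫ Q.X ◁ h ▷ Q.X ≫ Q.X ◁ Q.m ≫ Q.m) := by
        simp only [choi]
        generalize dag P.m = c
        have e : k ▷ (P.X ⊗ Q.X) ≫ Q.X ◁ h ▷ Q.X ≫ Q.X ◁ Q.m =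
            P.X ◁ (h ▷ Q.X ≫ Q.m) ≫ k ▷ Q.X := by
          rw [whisker_exchange, MonoidalCategory.whiskerLeft_comp]
        rw [reassoc_of% e]
        generalize h ▷ Q.X ≫ Q.m = w
        calc (c ▷ Q.X ≫ (α_ P.X P.X Q.X).hom ≫ P.X ◁ w) ≫
              c ▷ Q.X ≫ (α_ P.X P.X Q.X).hom ≫ P.X ◁ (k ▷ Q.X ≫ Q.m)
            = c ▷ Q.X ≫ (α_ P.X P.X Q.X).hom ≫ (P.X ◁ w ≫ c ▷ Q.X) ≫
              (α_ P.X P.X Q.X).hom ≫ P.X ◁ (k ▷ Q.X ≫ Q.m) := by simp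
          _ = _ := by
            rw [whisker_exchange]
            simp
    _ = (dag P.m ≫ P.X ◁ dag P.m) ▷ Q.X ≫ (α_ _ _ _).hom ≫
          P.X ◁ ((α_ _ _ _).hom ≫ k ▷ (P.X ⊗ Q.X) ≫ Q.X ◁ h ▷ Q.X ≫
            (α_ _ _ _).inv ≫ Q.m ▷ Q.X ≫ Q.m) := by
        rw [hc, assocQ]
    _ = choi (dag P.m ≫ (k ⊗ₘ h) ≫ Q.m) := by
        simp only [choi, MonoidalCategory.tensorHom_def]
        simp

/-- The hypothesis says that k is the conjugate of h under the two self-dualities. The adjoint of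
`choi h` contains m_Q† followed by h†. Writing m_Q† through the cup of Q lets h† be traded for k on
the cup of P, and the remaining m_P then absorbs that cup into m_P†. -/
lemma dag_choi (h k : P.X ⟶ Q.X) (hk : P.cup ≫ P.X ◁ k = Q.cup ≫ dag h ▷ Q.X) :
    dag (choi h) = choi k := by
  have e : dag Q.m ≫ dag h ▷ Q.X =
      (λ_ _).inv ≫ P.cup ▷ Q.X ≫ (α_ _ _ _).hom ≫ P.X ◁ (k ▷ Q.X ≫ Q.m) := by
    calc dag Q.m ≫ dag h ▷ Q.X
        = (λ_ _).inv ≫ (Q.cup ≫ dag h ▷ Q.X) ▷ Q.X ≫ (α_ _ _ _).hom ≫ P.X ◁ Q.m := by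
          rw [comul_eq_cup_left Q]
          simp [whisker_exchange]
      _ = _ := by
          rw [← hk]; simp
  simp only [choi, dag_comp, dag_whiskerLeft, dag_whiskerRight, dag_associator_hom, dag_dag]
  rw [e, comul_eq_cup_right P]
  generalize k ▷ Q.X ≫ Q.m = w
  have ex : P.m ▷ P.X ▷ Q.X ≫ (α_ P.X P.X Q.X).hom ≫ P.X ◁ w =
      (α_ (P.X ⊗ P.X) P.X Q.X).hom ≫ (P.X ⊗ P.X) ◁ w ≫ P.m ▷ Q.X := by
    rw [whisker_exchange]
    simp
  simp only [comp_whiskerRight, Category.assoc, ex]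
  simp

end Choi

/-! ### Matrices of maps which form a `*`-homomorphism -/

section MatrixStarHom

/-- The map `x ⊗ y ↦ (x ⊗ z) ⊗ y`. -/
def insertMid (V W : Hilb) {K : Hilb} (z : K) : V ⊗ W ⟶ (V ⊗ K) ⊗ W :=
  (⟨(TensorProduct.mk ℂ V K).flip z⟩ : V ⟶ V ⊗ K) ▷ W

lemma insertMid_tmul {V W K : Hilb} (z : K) (x : V) (y : W) :
    (insertMid V W z).lin (x ⊗ₜ[ℂ] y) = (x ⊗ₜ[ℂ] z) ⊗ₜ[ℂ] y := rfl

/-- Insertions along an orthonormal basis of K are therefore isometries with orthogonal ranges, and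
can serve to read off the blocks of a map on (V ⊗ K) ⊗ W. -/
lemma insertMid_comp_dag {V W K : Hilb} (z w : K) :
    insertMid V W z ≫ dag (insertMid V W w) = (inner ℂ w z : ℂ) • 𝟙 (V ⊗ W) := by
  have h : (⟨(TensorProduct.mk ℂ V K).flip z⟩ : V ⟶ V ⊗ K) ≫
      dag (⟨(TensorProduct.mk ℂ V K).flip w⟩ : V ⟶ V ⊗ K) = (inner ℂ w z : ℂ) • 𝟙 V := by
    apply hom_ext
    refine LinearMap.ext fun x => ext_inner_right ℂ fun y => ?_
    rw [comp_lin, LinearMap.comp_apply, dag_lin, LinearMap.adjoint_inner_left]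
    change inner ℂ (x ⊗ₜ[ℂ] z) (y ⊗ₜ[ℂ] w) = inner ℂ ((inner ℂ w z : ℂ) • x) y
    rw [TensorProduct.inner_tmul, inner_smul_left, inner_conj_symm, mul_comm]
  rw [insertMid, insertMid, dag_whiskerRight, ← comp_whiskerRight, h]
  apply hom_ext
  refine TensorProduct.ext' fun x y => ?_
  change ((inner ℂ w z : ℂ) • x) ⊗ₜ[ℂ] y = (inner ℂ w z : ℂ) • (x ⊗ₜ[ℂ] y)
  rw [TensorProduct.smul_tmul']

lemma insertMid_ext {V W K Z : Hilb} {κ : Type*} [Fintype κ] (c : OrthonormalBasis κ ℂ K)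
    {f g : (V ⊗ K) ⊗ W ⟶ Z} (h : ∀ k, insertMid V W (c k) ≫ f = insertMid V W (c k) ≫ g) :
    f = g := by
  apply hom_ext
  refine TensorProduct.ext_threefold fun x z y => ?_
  rw [← c.sum_repr' z]
  simp only [TensorProduct.tmul_sum, TensorProduct.sum_tmul, TensorProduct.tmul_smul,
    ← TensorProduct.smul_tmul', map_sum, map_smul]
  refine Finset.sum_congr rfl fun k _ => ?_
  have := LinearMap.congr_fun (congrArg Hom.lin (h k)) (x ⊗ₜ[ℂ] y)
  rw [comp_lin, comp_lin, LinearMap.comp_apply, LinearMap.comp_apply, insertMid_tmul] at this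
  rw [this]

/-- A map is determined by its blocks: the one-sided criterion is used on the source, and again on
the target after taking adjoints. -/
lemma insertMid_ext₂ {V W K : Hilb} {κ : Type*} [Fintype κ] (c : OrthonormalBasis κ ℂ K)
    {f g : (V ⊗ K) ⊗ W ⟶ (V ⊗ K) ⊗ W}
    (h : ∀ k l, insertMid V W (c k) ≫ f ≫ dag (insertMid V W (c l)) =
      insertMid V W (c k) ≫ g ≫ dag (insertMid V W (c l))) : f = g := by
  refine insertMid_ext c fun k => ?_
  have := insertMid_ext c (f := dag (insertMid V W (c k) ≫ f))
    (g := dag (insertMid V W (c k) ≫ g)) fun l => by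
      simpa only [dag_comp, dag_dag, Category.assoc] using congrArg dag (h k l)
  simpa only [dag_dag] using congrArg dag this

variable {P Q : FrobAlg Hilb} {H : Hilb} {ι : Type} [Fintype ι]

/-- The matrix `γ` of maps `P → Q` defines a counit-preserving `*`-homomorphism from `P` to
matrices over `Q`. -/
structure MatrixStarHom [DecidableEq ι] (P Q : FrobAlg Hilb) (γ : ι → ι → (P.X ⟶ Q.X)) : Prop where
  mul : ∀ i k, P.m ≫ γ i k = ∑ j, (γ i j ⊗ₘ γ j k) ≫ Q.m
  counit : ∀ i k, γ i k ≫ dag Q.u = if i = k then dag P.u else 0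
  star : ∀ k l, P.cup ≫ P.X ◁ γ l k = Q.cup ≫ dag (γ k l) ▷ Q.X

lemma sqrtDim_ne_zero [Nontrivial H] : sqrtDim H ≠ 0 := by
  have : Module.finrank ℂ H ≠ 0 := Module.finrank_pos.ne'
  simpa [sqrtDim, Complex.ofReal_eq_zero, Real.sqrt_eq_zero'] using this

/-- The morphism in the CP condition for a map `P ⊗ B(H) → Q`. -/
def tensorChoi (b : OrthonormalBasis ι ℂ H) (E : P.X ⊗ (H ⊗ H) ⟶ Q.X) :
    (P.X ⊗ (H ⊗ H)) ⊗ Q.X ⟶ (P.X ⊗ (H ⊗ H)) ⊗ Q.X :=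
  dag (tensorμ P.X (H ⊗ H) P.X (H ⊗ H) ≫ (P.m ⊗ₘ boundedMul b)) ▷ Q.X ≫
    (α_ (P.X ⊗ (H ⊗ H)) (P.X ⊗ (H ⊗ H)) Q.X).hom ≫ (P.X ⊗ (H ⊗ H)) ◁ (E ▷ Q.X ≫ Q.m)

/-- The comultiplication of B(H) sends |i⟩ ⊗ |j⟩ to d^(-1/2) ∑ₚ (|i⟩ ⊗ |p⟩) ⊗ (|p⟩ ⊗ |j⟩). The index
i is carried along unchanged while E sees |p⟩ ⊗ |j⟩ and contributes √d γ_pj, so the constants cancel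
and the Choi morphism is id_H ⊗ N with blocks `choi (γ p j)`. -/
lemma insertMid_comp_tensorChoi [Nontrivial H] (b : OrthonormalBasis ι ℂ H)
    (γ : ι → ι → (P.X ⟶ Q.X)) (E : P.X ⊗ (H ⊗ H) ⟶ Q.X)
    (hE : ∀ x j k, E.lin (x ⊗ₜ[ℂ] (b j ⊗ₜ[ℂ] b k)) = sqrtDim H • (γ j k).lin x) (i j : ι) :
    insertMid P.X Q.X (K := H ⊗ H) (b i ⊗ₜ[ℂ] b j) ≫ tensorChoi b E =
      ∑ p, choi (γ p j) ≫ insertMid P.X Q.X (K := H ⊗ H) (b i ⊗ₜ[ℂ] b p) := by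
  apply hom_ext
  refine TensorProduct.ext' fun x y => ?_
  rw [sum_lin_apply]
  change ((α_ (P.X ⊗ (H ⊗ H)) (P.X ⊗ (H ⊗ H)) Q.X).hom ≫
      (P.X ⊗ (H ⊗ H)) ◁ (E ▷ Q.X ≫ Q.m)).lin
        ((dag (tensorμ P.X (H ⊗ H) P.X (H ⊗ H) ≫ (P.m ⊗ₘ boundedMul b))).lin
          (x ⊗ₜ[ℂ] (b i ⊗ₜ[ℂ] b j)) ⊗ₜ[ℂ] y) =
    ∑ p, (insertMid P.X Q.X (K := H ⊗ H) (b i ⊗ₜ[ℂ] b p)).lin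
      (((α_ P.X P.X Q.X).hom ≫ P.X ◁ (γ p j ▷ Q.X ≫ Q.m)).lin ((dag P.m).lin x ⊗ₜ[ℂ] y))
  rw [dag_comp, dag_tensorHom]
  have e : ((dag P.m ⊗ₘ dag (boundedMul b)) ≫ dag (tensorμ P.X (H ⊗ H) P.X (H ⊗ H))).lin
      (x ⊗ₜ[ℂ] (b i ⊗ₜ[ℂ] b j)) = (dag (tensorμ P.X (H ⊗ H) P.X (H ⊗ H))).lin
      ((dag P.m).lin x ⊗ₜ[ℂ] (dag (boundedMul b)).lin (b i ⊗ₜ[ℂ] b j)) := rfl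
  rw [e, dag_boundedMul_tmul]
  generalize (dag P.m).lin x = s
  induction s using TensorProduct.induction_on with
  | zero => simp only [TensorProduct.zero_tmul, map_zero, Finset.sum_const_zero]
  | add s s' h h' => simp only [TensorProduct.add_tmul, map_add, h, h', Finset.sum_add_distrib]
  | tmul x₁ x₂ =>
    rw [TensorProduct.tmul_smul, TensorProduct.tmul_sum, map_smul, map_sum,
      ← TensorProduct.smul_tmul', TensorProduct.sum_tmul, map_smul, map_sum, Finset.smul_sum]
    refine Finset.sum_congr rfl fun p _ => ?_
    rw [dag_tensorμ_tmul]
    change (sqrtDim H)⁻¹ • ((x₁ ⊗ₜ[ℂ] (b i ⊗ₜ[ℂ] b p)) ⊗ₜ[ℂ]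
        Q.m.lin (E.lin (x₂ ⊗ₜ[ℂ] (b p ⊗ₜ[ℂ] b j)) ⊗ₜ[ℂ] y)) =
      (x₁ ⊗ₜ[ℂ] (b i ⊗ₜ[ℂ] b p)) ⊗ₜ[ℂ] Q.m.lin ((γ p j).lin x₂ ⊗ₜ[ℂ] y)
    rw [hE, ← TensorProduct.smul_tmul', map_smul, TensorProduct.tmul_smul, smul_smul,
      inv_mul_cancel₀ sqrtDim_ne_zero, one_smul]

lemma insertMid_tensor_orthonormal [DecidableEq ι] (b : OrthonormalBasis ι ℂ H) {V W : Hilb}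
    (i j k l : ι) :
    insertMid V W (K := H ⊗ H) (b i ⊗ₜ[ℂ] b j) ≫
      dag (insertMid V W (K := H ⊗ H) (b k ⊗ₜ[ℂ] b l)) = if k = i ∧ l = j then 𝟙 _ else 0 := by
  rw [insertMid_comp_dag]
  have : (inner ℂ (b k ⊗ₜ[ℂ] b l) (b i ⊗ₜ[ℂ] b j) : ℂ) = if k = i ∧ l = j then 1 else 0 := by
    rw [TensorProduct.inner_tmul, orthonormal_iff_ite.mp b.orthonormal,
      orthonormal_iff_ite.mp b.orthonormal]
    by_cases h₁ : k = i <;> by_cases h₂ : l = j <;> simp [h₁, h₂]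
  change (inner ℂ (b k ⊗ₜ[ℂ] b l) (b i ⊗ₜ[ℂ] b j) : ℂ) • _ = _
  rw [this]
  split <;> simp

/-- A block matrix `id_H ⊗ N` with `N` a projection is a projection. -/
lemma eq_comp_dag_of_blocks [DecidableEq ι] (b : OrthonormalBasis ι ℂ H) {V W : Hilb}
    (M : (V ⊗ (H ⊗ H)) ⊗ W ⟶ (V ⊗ (H ⊗ H)) ⊗ W) (N : ι → ι → (V ⊗ W ⟶ V ⊗ W))
    (key : ∀ i j, insertMid V W (K := H ⊗ H) (b i ⊗ₜ[ℂ] b j) ≫ M =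
      ∑ p, N p j ≫ insertMid V W (K := H ⊗ H) (b i ⊗ₜ[ℂ] b p))
    (idem : ∀ p j, ∑ q, N q j ≫ N p q = N p j) (self : ∀ p j, dag (N p j) = N j p) :
    M = M ≫ dag M := by
  have entry : ∀ i j k l, insertMid V W (K := H ⊗ H) (b i ⊗ₜ[ℂ] b j) ≫ M ≫
      dag (insertMid V W (K := H ⊗ H) (b k ⊗ₜ[ℂ] b l)) = if k = i then N l j else 0 := by
    intro i j k l
    rw [← Category.assoc, key, Preadditive.sum_comp]
    simp only [Category.assoc, insertMid_tensor_orthonormal]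
    by_cases h : k = i
    · rw [Finset.sum_eq_single l] <;> simp +contextual [h, eq_comm]
    · simp [h]
  have tens : ∀ i j, ((b.tensorProduct b) (i, j) : H ⊗[ℂ] H) = b i ⊗ₜ[ℂ] b j :=
    fun i j => OrthonormalBasis.tensorProduct_apply b b i j
  -- Block by block: the dagger exchanges source and target indices, and `self` undoes this exchange
  -- on N.
  have hdag : dag M = M := by
    refine insertMid_ext₂ (K := H ⊗ H) (b.tensorProduct b) ?_
    rintro ⟨i, j⟩ ⟨k, l⟩
    erw [tens, tens]
    rw [entry]
    have := congrArg dag (entry k l i j)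
    simp only [dag_comp, dag_dag, Category.assoc] at this
    rw [this]
    by_cases h : i = k
    · simp [h, self]
    · simp [h, Ne.symm h, dag_zero]
  -- With M self-adjoint, only idempotency M = M ≫ M is left. The first index i is untouched by both
  -- factors, so `idem` on the second index suffices.
  rw [hdag]
  refine insertMid_ext (K := H ⊗ H) (b.tensorProduct b) ?_
  rintro ⟨i, j⟩
  erw [tens]
  rw [← Category.assoc, key, Preadditive.sum_comp]
  simp only [Category.assoc, key, Preadditive.comp_sum]
  rw [Finset.sum_comm]
  refine Finset.sum_congr rfl fun p _ => ?_
  rw [← idem p j, Preadditive.sum_comp]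
  simp only [Category.assoc]

lemma capVal_basis [DecidableEq ι] (b : OrthonormalBasis ι ℂ H) (j k : ι) :
    capVal b (b j) (b k) = if j = k then 1 else 0 := by
  simp [capVal, orthonormal_iff_ite.mp b.orthonormal, eq_comm]

lemma dag_cup (b : OrthonormalBasis ι ℂ H) : dag (cup b) = cap b := by
  apply hom_ext
  refine TensorProduct.ext' fun x y => ext_inner_left ℂ fun (z : ℂ) => ?_
  rw [dag_lin, LinearMap.adjoint_inner_right, cap_tmul]
  change inner ℂ (z • ∑ i, b i ⊗ₜ[ℂ] b i) (x ⊗ₜ[ℂ] y) = inner ℂ z (capVal b x y)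
  have h : ∀ (u : ι → H ⊗[ℂ] H) (v : H ⊗[ℂ] H),
      inner ℂ (z • ∑ i, u i) v = (starRingEnd ℂ) z * ∑ i, inner ℂ (u i) v := fun u v => by
    rw [← sum_inner (𝕜 := ℂ) Finset.univ u v]
    exact inner_smul_left _ v z
  rw [h]
  simp only [TensorProduct.inner_tmul, capVal, RCLike.inner_apply]
  rw [mul_comm]

lemma dag_leftUnitor_inv (V : Hilb) : dag (λ_ V).inv = (λ_ V).hom := by
  rw [← dag_dag (λ_ V).hom]
  exact congrArg dag (dag_isoOfEquiv _ TensorProduct.inner_lid_lid).symm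

lemma dag_smul {V W : Hilb} (c : ℂ) (f : V ⟶ W) :
    dag (c • f) = (starRingEnd ℂ) c • dag f := by
  apply hom_ext
  rw [dag_lin, smul_lin, smul_lin, map_smulₛₗ]
  rfl

/-- The map `x ⊗ |j⟩ ⊗ |k⟩ ↦ √d γ_jk(x)` defined by a matrix `*`-homomorphism is a channel. -/
theorem MatrixStarHom.isChannel [DecidableEq ι] [Nontrivial H] (b : OrthonormalBasis ι ℂ H)
    {γ : ι → ι → (P.X ⟶ Q.X)} (hγ : MatrixStarHom P Q γ) (hP : P.IsSpecial)
    (E : P.X ⊗ (H ⊗ H) ⟶ Q.X)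
    (hE : ∀ x j k, E.lin (x ⊗ₜ[ℂ] (b j ⊗ₜ[ℂ] b k)) = sqrtDim H • (γ j k).lin x) :
    FrobAlg.IsChannel (tensorFrob P (bounded b)) Q E where
  cp := by
    -- The Choi morphism is its own square root, since it is a projection.
    refine ⟨_, tensorChoi b E, ?_⟩
    refine eq_comp_dag_of_blocks b (tensorChoi b E) (fun p j => choi (γ p j))
      (insertMid_comp_tensorChoi b γ E hE) (fun p j => ?_) fun p j => dag_choi _ _ (hγ.star p j)
    simp only [choi_comp_choi]
    -- The convolution sum over the middle index is m_P† followed by m_P and γ_pj, by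
    -- multiplicativity; speciality removes the first two.
    rw [← choi_sum, ← Preadditive.comp_sum, ← hγ.mul, ← Category.assoc,
      show dag P.m ≫ P.m = 𝟙 _ from hP, Category.id_comp]
  counit := by
    change E ≫ dag Q.u = dag ((λ_ (𝟙_ Hilb)).inv ≫ (P.u ⊗ₘ (sqrtDim H • cup b)))
    rw [dag_comp, dag_tensorHom, dag_leftUnitor_inv, dag_smul, dag_cup]
    have hs : (starRingEnd ℂ) (sqrtDim H) = sqrtDim H := by simp [sqrtDim]
    rw [hs]
    apply hom_ext
    refine TensorProduct.ext ?_
    refine LinearMap.ext fun x => ?_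
    refine (b.tensorProduct b).toBasis.ext ?_
    rintro ⟨j, k⟩
    rw [OrthonormalBasis.coe_toBasis, OrthonormalBasis.tensorProduct_apply]
    -- Both sides carry one factor √d, from E and from the unit of B(H) respectively, and both
    -- vanish off the diagonal j = k.
    change (dag Q.u).lin (E.lin (x ⊗ₜ[ℂ] (b j ⊗ₜ[ℂ] b k))) =
      (show ℂ from (dag P.u).lin x) • (show ℂ from sqrtDim H • (cap b).lin (b j ⊗ₜ[ℂ] b k))
    have hc := LinearMap.congr_fun (congrArg Hom.lin (hγ.counit j k)) x
    rw [comp_lin, LinearMap.comp_apply] at hc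
    rw [hE, map_smul, hc, cap_tmul, smul_comm]
    congr 1
    rw [capVal_basis]
    split <;> simp

end MatrixStarHom

/-! ### `*`-preservation from unitarity -/

/-- Positivity: the expectation of the sum at x is ∑ ‖fᵢ x‖², so every summand vanishes. -/
lemma eq_zero_of_sum_comp_dag {κ : Type*} [Fintype κ] {V W : Hilb} {f : κ → (V ⟶ W)}
    (h : ∑ i, f i ≫ dag (f i) = 0) (i : κ) : f i = 0 := by
  apply hom_ext
  refine LinearMap.ext fun x => ?_
  have h₁ : ∑ i, ‖(f i).lin x‖ ^ 2 = 0 := by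
    have := congrArg (fun g : V ⟶ V => (inner ℂ x (g.lin x) : ℂ)) h
    simp only [sum_lin_apply, inner_sum, comp_lin, LinearMap.comp_apply, dag_lin,
      LinearMap.adjoint_inner_right, zero_lin, LinearMap.zero_apply, inner_zero_right,
      inner_self_eq_norm_sq_to_K] at this
    exact (RCLike.ofReal_eq_zero (K := ℂ)).mp (by push_cast; exact this)
  have h₂ := (Finset.sum_eq_zero_iff_of_nonneg fun i _ => sq_nonneg ‖(f i).lin x‖).mp h₁ i
    (Finset.mem_univ i)
  simpa using h₂

lemma whiskerLeft_nsmul_id (V W : Hilb) (n : ℕ) : V ◁ (n • 𝟙 W) = n • 𝟙 (V ⊗ W) := by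
  induction n with
  | zero => simp
  | succ n ih => simp only [succ_nsmul, MonoidalPreadditive.whiskerLeft_add, ih, whiskerLeft_id]

lemma nsmul_id_whiskerRight (V W : Hilb) (n : ℕ) : (n • 𝟙 W) ▷ V = n • 𝟙 (W ⊗ V) := by
  induction n with
  | zero => simp
  | succ n ih => simp only [succ_nsmul, MonoidalPreadditive.add_whiskerRight, ih, id_whiskerRight]

section Star

variable {P Q : FrobAlg Hilb} {ι : Type} [Fintype ι] [DecidableEq ι]

/-- The properties of the matrix of maps given by the component of a unitary pseudonatural
transformation at a Frobenius algebra. -/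
structure UnitaryMatrixHom (P Q : FrobAlg Hilb) (γ : ι → ι → (P.X ⟶ Q.X)) : Prop where
  mul : ∀ i k, P.m ≫ γ i k = ∑ j, (γ i j ⊗ₘ γ j k) ≫ Q.m
  comul : ∀ i k, γ i k ≫ dag Q.m = ∑ j, dag P.m ≫ (γ i j ⊗ₘ γ j k)
  unit : ∀ i k, P.u ≫ γ i k = if i = k then Q.u else 0
  counit : ∀ i k, γ i k ≫ dag Q.u = if i = k then dag P.u else 0
  isometry : ∑ i, ∑ k, γ i k ≫ dag (γ i k) = Fintype.card ι • 𝟙 P.X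
  coisometry : ∑ i, ∑ k, dag (γ i k) ≫ γ i k = Fintype.card ι • 𝟙 Q.X

lemma dag_frobCup (P : FrobAlg Hilb) : dag P.cup = P.cap := by
  rw [FrobAlg.cup, FrobAlg.cap, dag_comp, dag_dag]

namespace UnitaryMatrixHom

variable {γ : ι → ι → (P.X ⟶ Q.X)}

/-- The adjoint matrix has the same properties. -/
lemma adjoint (h : UnitaryMatrixHom P Q γ) : UnitaryMatrixHom Q P fun i k => dag (γ i k) where
  mul i k := by
    simpa only [dag_comp, dag_dag, dag_sum, dag_tensorHom] using congrArg dag (h.comul i k)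
  comul i k := by
    simpa only [dag_comp, dag_dag, dag_sum, dag_tensorHom] using congrArg dag (h.mul i k)
  unit i k := by
    have := congrArg dag (h.counit i k)
    rw [dag_comp, dag_dag] at this
    rw [this]
    split <;> simp [dag_dag, dag_zero]
  counit i k := by
    rw [← dag_comp, h.unit]
    split <;> simp [dag_zero]
  isometry := by simpa only [dag_dag] using h.coisometry
  coisometry := by simpa only [dag_dag] using h.isometry

/-- Since the cup is m† applied to the unit, comultiplicativity and unitality transport it. No
involution axiom is needed, which is what makes the later derivation of that axiom possible. -/
lemma cup_comp (h : UnitaryMatrixHom P Q γ) (i k : ι) :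
    ∑ j, P.cup ≫ (γ i j ⊗ₘ γ j k) = if i = k then Q.cup else 0 := by
  simp only [FrobAlg.cup, Category.assoc]
  rw [← Preadditive.comp_sum, ← h.comul, ← Category.assoc, h.unit]
  split <;> simp

lemma comp_cap (h : UnitaryMatrixHom P Q γ) (i k : ι) :
    ∑ j, (γ i j ⊗ₘ γ j k) ≫ Q.cap = if i = k then P.cap else 0 := by
  simp only [FrobAlg.cap, ← Category.assoc]
  rw [← Preadditive.sum_comp, ← h.mul, Category.assoc, h.counit]
  split <;> simp

/-- Evaluating ∑ⱼ cap_Q ∘ (γ_ij ⊗ γ_ji) ∘ cup_P in two ways, by transporting the cup or the cap. The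
common scalar makes the two total norms in `star_right` equal. -/
lemma cup_comp_cap (h : UnitaryMatrixHom P Q γ) [Nonempty ι] :
    P.cup ≫ P.cap = Q.cup ≫ Q.cap := by
  obtain ⟨i⟩ := ‹Nonempty ι›
  have h₁ := congrArg (fun g => g ≫ Q.cap) (h.cup_comp i i)
  have h₂ := congrArg (fun g => P.cup ≫ g) (h.comp_cap i i)
  simp only [if_true, Preadditive.sum_comp, Preadditive.comp_sum, Category.assoc] at h₁ h₂
  rw [← h₁, ← h₂]

/-- If `(f_i)`, `(g_i)` have total squared norm and total overlap all equal, then `f_i = g_i`. -/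
lemma eq_of_sum_comp_dag {κ : Type*} [Fintype κ] {V W : Hilb} {f g : κ → (V ⟶ W)} {s : V ⟶ V}
    (hf : ∑ i, f i ≫ dag (f i) = s) (hg : ∑ i, g i ≫ dag (g i) = s)
    (hfg : ∑ i, f i ≫ dag (g i) = s) (i : κ) : f i = g i := by
  -- The reversed overlap is the adjoint of the given one, and s is self-adjoint because it is a sum
  -- of terms f ≫ f†.
  have hgf : ∑ i, g i ≫ dag (f i) = s := by
    have h₁ := congrArg dag hfg
    have h₂ := congrArg dag hf
    simp only [dag_sum, dag_comp, dag_dag] at h₁ h₂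
    rw [h₁, ← h₂, hf]
  have dag_sub : ∀ a b : V ⟶ W, dag (a - b) = dag a - dag b := fun a b =>
    hom_ext (map_sub LinearMap.adjoint a.lin b.lin)
  -- Expanding the squared norm of the differences gives s − s − s + s = 0.
  refine sub_eq_zero.mp (eq_zero_of_sum_comp_dag (f := fun i => f i - g i) ?_ i)
  simp only [dag_sub, Preadditive.sub_comp, Preadditive.comp_sub, Finset.sum_sub_distrib, hf, hg,
    hfg, hgf]
  simp

/-- The involution axiom, obtained by comparing the two sides as families of vectors of P ⊗ Q
indexed by all pairs (k, l). Both total squared norms and the total overlap equal d times the scalar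
cap ∘ cup, so the families agree entrywise. The norms use unitarity; the overlap uses the transport
of cups. -/
lemma star_right (h : UnitaryMatrixHom P Q γ) [Nonempty ι] (k l : ι) :
    P.cup ≫ P.X ◁ γ l k = Q.cup ≫ dag (γ k l) ▷ Q.X := by
  refine eq_of_sum_comp_dag (κ := ι × ι) (f := fun p => P.cup ≫ P.X ◁ γ p.2 p.1)
    (g := fun p => Q.cup ≫ dag (γ p.1 p.2) ▷ Q.X) (s := Fintype.card ι • (Q.cup ≫ Q.cap))
    ?_ ?_ ?_ (k, l)
  · simp only [Fintype.sum_prod_type_right, dag_comp, dag_whiskerLeft, Category.assoc,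
      dag_frobCup]
    simp only [← MonoidalCategory.whiskerLeft_comp_assoc, ← Preadditive.comp_sum,
      ← Preadditive.sum_comp, ← whiskerLeft_sum, h.isometry, whiskerLeft_nsmul_id]
    rw [Preadditive.nsmul_comp, Preadditive.comp_nsmul, Category.id_comp, h.cup_comp_cap]
  · simp only [Fintype.sum_prod_type, dag_comp, dag_whiskerRight, Category.assoc,
      dag_frobCup, dag_dag]
    simp only [← comp_whiskerRight_assoc, ← Preadditive.comp_sum,
      ← Preadditive.sum_comp, ← sum_whiskerRight, h.coisometry,
      nsmul_id_whiskerRight]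
    rw [Preadditive.nsmul_comp, Preadditive.comp_nsmul, Category.id_comp]
  · simp only [Fintype.sum_prod_type, dag_comp, dag_whiskerRight, Category.assoc, dag_frobCup,
      dag_dag]
    -- The transposed index in the first family makes the cross terms chain as γ_ij ⊗ γ_ji, so
    -- summing over j transports the cup and the sum over i contributes the factor d.
    have e : ∀ i j, P.cup ≫ P.X ◁ γ j i ≫ γ i j ▷ Q.X ≫ Q.cap =
        (P.cup ≫ (γ i j ⊗ₘ γ j i)) ≫ Q.cap := by
      intro i j
      rw [MonoidalCategory.tensorHom_def', Category.assoc, Category.assoc]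
    simp only [e, ← Preadditive.sum_comp, h.cup_comp]
    simp

lemma matrixStarHom (h : UnitaryMatrixHom P Q γ) [Nonempty ι] : MatrixStarHom P Q γ :=
  ⟨h.mul, h.counit, h.star_right⟩

end UnitaryMatrixHom

end Star

/-! ### Matrix entries of a map `V ⊗ H → H ⊗ W` -/

section Entry

variable {H V W : Hilb} {ι : Type} [Fintype ι] (b : OrthonormalBasis ι ℂ H)

/-- The map `⟨b_j| ⊗ id : H ⊗ W → W`. -/
def bra (W : Hilb) (j : ι) : H ⊗[ℂ] W →ₗ[ℂ] W :=
  (TensorProduct.lid ℂ W).toLinearMap ∘ₗ (innerₛₗ ℂ (b j)).rTensor W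

lemma bra_tmul (j : ι) (h : H) (w : W) : bra b W j (h ⊗ₜ[ℂ] w) = inner ℂ (b j) h • w := rfl

lemma bra_sum [DecidableEq ι] (j : ι) (w : ι → W) : bra b W j (∑ i, b i ⊗ₜ[ℂ] w i) = w j := by
  simp [bra_tmul, orthonormal_iff_ite.mp b.orthonormal]

lemma sum_bra (t : H ⊗[ℂ] W) : ∑ j, b j ⊗ₜ[ℂ] bra b W j t = t := by
  induction t using TensorProduct.induction_on with
  | zero => simp
  | add s t hs ht => simp only [map_add, TensorProduct.tmul_add, Finset.sum_add_distrib, hs, ht]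
  | tmul h w =>
    simp only [bra_tmul, ← TensorProduct.smul_tmul]
    rw [← TensorProduct.sum_tmul, b.sum_repr' h]

/-- The entry `γ_jk` of `γ`, where `γ (x ⊗ |k⟩) = ∑ |j⟩ ⊗ γ_jk x`. -/
def entry (γ : V ⊗ H ⟶ H ⊗ W) (j k : ι) : V ⟶ W :=
  ⟨bra b W j ∘ₗ γ.lin ∘ₗ (TensorProduct.mk ℂ V H).flip (b k)⟩

lemma entry_lin (γ : V ⊗ H ⟶ H ⊗ W) (j k : ι) (x : V) :
    (entry b γ j k).lin x = bra b W j (γ.lin (x ⊗ₜ[ℂ] b k)) := rfl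

lemma lin_tmul (γ : V ⊗ H ⟶ H ⊗ W) (x : V) (k : ι) :
    γ.lin (x ⊗ₜ[ℂ] b k) = ∑ j, b j ⊗ₜ[ℂ] (entry b γ j k).lin x := by
  simp only [entry_lin]
  exact (sum_bra b _).symm

lemma entry_eq [DecidableEq ι] {γ : V ⊗ H ⟶ H ⊗ W} {f : ι → ι → (V ⟶ W)}
    (h : ∀ x k, γ.lin (x ⊗ₜ[ℂ] b k) = ∑ j, b j ⊗ₜ[ℂ] (f j k).lin x) (j k : ι) :
    entry b γ j k = f j k := by
  apply hom_ext
  refine LinearMap.ext fun x => ?_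
  rw [entry_lin, h]
  exact bra_sum b j fun i => (f i k).lin x

/-- The adjoint of a block matrix is its conjugate transpose; checked by pairing with the vectors x
⊗ |l⟩. -/
lemma dag_lin_tmul (γ : V ⊗ H ⟶ H ⊗ W) (j : ι) (y : W) :
    (dag γ).lin (b j ⊗ₜ[ℂ] y) = ∑ k, (dag (entry b γ j k)).lin y ⊗ₜ[ℂ] b k := by
  classical
  refine ext_inner_right ℂ fun t => ?_
  have : innerₛₗ ℂ ((dag γ).lin (b j ⊗ₜ[ℂ] y) : V ⊗[ℂ] H) =
      innerₛₗ ℂ (∑ k, (dag (entry b γ j k)).lin y ⊗ₜ[ℂ] b k : V ⊗[ℂ] H) := by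
    refine TensorProduct.ext (LinearMap.ext fun x => b.toBasis.ext fun l => ?_)
    rw [OrthonormalBasis.coe_toBasis]
    change inner ℂ ((dag γ).lin (b j ⊗ₜ[ℂ] y)) (x ⊗ₜ[ℂ] b l) =
      inner ℂ (∑ k, (dag (entry b γ j k)).lin y ⊗ₜ[ℂ] b k) (x ⊗ₜ[ℂ] b l)
    rw [dag_lin, LinearMap.adjoint_inner_left, lin_tmul b γ x l]
    refine (inner_sum (𝕜 := ℂ) (E := H ⊗[ℂ] W) _ _ _).trans ?_
    rw [sum_inner]
    simp only [TensorProduct.inner_tmul, orthonormal_iff_ite.mp b.orthonormal, dag_lin,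
      LinearMap.adjoint_inner_left]
    simp
  exact LinearMap.congr_fun this t

/-- The second copy of H feeds the column index k into γ, and the cap against the first copy selects
the row j. This identifies the diagrammatic `u` and `v` with the explicit formulas. -/
lemma bend_tmul (γ : V ⊗ H ⟶ H ⊗ W) (x : V) (j k : ι) :
    (bend b γ).lin (x ⊗ₜ[ℂ] (b j ⊗ₜ[ℂ] b k)) = sqrtDim H • (entry b γ j k).lin x := by
  classical
  change sqrtDim H • ((α_ H H W).inv ≫ cap b ▷ W ≫ (λ_ W).hom).lin
    (b j ⊗ₜ[ℂ] γ.lin (x ⊗ₜ[ℂ] b k)) = _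
  congr 1
  rw [lin_tmul, TensorProduct.tmul_sum, map_sum]
  have : ∀ i, ((α_ H H W).inv ≫ cap b ▷ W ≫ (λ_ W).hom).lin
      (b j ⊗ₜ[ℂ] (b i ⊗ₜ[ℂ] (entry b γ i k).lin x)) =
      (show ℂ from (cap b).lin (b j ⊗ₜ[ℂ] b i)) • (entry b γ i k).lin x := fun _ => rfl
  simp only [this, cap_tmul, capVal_basis]
  simp

/-- The (k, k) block of the isometry equation; the coisometry equation similarly gives the sum along
a row. -/
lemma sum_entry_comp_dag [DecidableEq ι] {γ : V ⊗ H ⟶ H ⊗ W} (h : γ ≫ dag γ = 𝟙 _) (k : ι) :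
    ∑ j, entry b γ j k ≫ dag (entry b γ j k) = 𝟙 V := by
  apply hom_ext
  refine LinearMap.ext fun x => ?_
  have e := LinearMap.congr_fun (congrArg Hom.lin h) (x ⊗ₜ[ℂ] b k)
  rw [comp_lin, LinearMap.comp_apply, lin_tmul b, map_sum] at e
  simp only [dag_lin_tmul] at e
  have e₂ := congrArg (fun t => bra b V k (TensorProduct.comm ℂ V H t)) e
  simp only [map_sum, TensorProduct.comm_tmul, bra_tmul, orthonormal_iff_ite.mp b.orthonormal,
    id_lin, LinearMap.id_apply] at e₂
  simp at e₂
  rw [sum_lin_apply]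
  simpa using e₂

lemma sum_dag_comp_entry [DecidableEq ι] {γ : V ⊗ H ⟶ H ⊗ W} (h : dag γ ≫ γ = 𝟙 _) (j : ι) :
    ∑ k, dag (entry b γ j k) ≫ entry b γ j k = 𝟙 W := by
  apply hom_ext
  refine LinearMap.ext fun y => ?_
  have e := LinearMap.congr_fun (congrArg Hom.lin h) (b j ⊗ₜ[ℂ] y)
  rw [comp_lin, LinearMap.comp_apply, dag_lin_tmul, map_sum] at e
  simp only [lin_tmul] at e
  have e₂ := congrArg (fun t => bra b W j t) e
  simp only [map_sum, bra_tmul, orthonormal_iff_ite.mp b.orthonormal,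
    id_lin, LinearMap.id_apply] at e₂
  simp at e₂
  rw [sum_lin_apply]
  simpa using e₂

end Entry

end Hilb

/-! ### Fibre functors preserve special Frobenius algebras and channels -/

namespace FibreFunctor

variable {C : Type*} [Category C] [MonoidalCategory C] [DaggerCategory C] [Preadditive C]
  [Linear ℂ C] (U : FibreFunctor C)

lemma mapFrob_isSpecial {A : FrobAlg C} (hA : A.IsSpecial) : (U.mapFrob A).IsSpecial := by
  change dag (U.μ A.X A.X ≫ U.F.map A.m) ≫ U.μ A.X A.X ≫ U.F.map A.m = 𝟙 (U.F.obj A.X)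
  have h : dag A.m ≫ A.m = 𝟙 A.X := hA
  rw [dag_comp, Category.assoc, ← Category.assoc (dag (U.μ A.X A.X)), (U.μ_unitary _ _).2,
    Category.id_comp, ← U.map_dag, ← Functor.map_comp, h, CategoryTheory.Functor.map_id]

/-- The image of a factorisation through g is conjugated by the unitary multiplicator, so
precomposing the image of g with μ gives a factorisation for the image algebras. -/
lemma mapFrob_isChannel {A B : FrobAlg C} {f : A.X ⟶ B.X} (hf : FrobAlg.IsChannel A B f) :
    FrobAlg.IsChannel (U.mapFrob A) (U.mapFrob B) (U.F.map f) where
  cp := by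
    obtain ⟨Z, g, hg⟩ := hf.cp
    refine ⟨U.F.obj Z, U.μ A.X B.X ≫ U.F.map g, ?_⟩
    change dag (U.μ A.X A.X ≫ U.F.map A.m) ▷ U.F.obj B.X ≫
      (α_ (U.F.obj A.X) (U.F.obj A.X) (U.F.obj B.X)).hom ≫
      U.F.obj A.X ◁ (U.F.map f ▷ U.F.obj B.X ≫ U.μ B.X B.X ≫ U.F.map B.m) =
      (U.μ A.X B.X ≫ U.F.map g) ≫ dag (U.μ A.X B.X ≫ U.F.map g)
    have h := congrArg (fun f => U.μ A.X B.X ≫ U.F.map f ≫ dag (U.μ A.X B.X)) hg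
    simp only [Functor.map_comp, Functor.Monoidal.map_whiskerRight, U.dag_μ,
      Functor.Monoidal.map_whiskerLeft, Functor.Monoidal.map_associator] at h
    simp only [dag_comp, ← U.map_dag, U.dag_μ]
    simpa only [Category.assoc, comp_whiskerRight, MonoidalCategory.whiskerLeft_comp,
      Functor.Monoidal.μ_δ_assoc, Functor.Monoidal.μ_δ, Category.comp_id,
      Functor.Monoidal.whiskerLeft_μ_δ_assoc] using h
  counit := by
    change U.F.map f ≫ dag (U.υ ≫ U.F.map B.u) = dag (U.υ ≫ U.F.map A.u)
    rw [dag_comp, dag_comp, ← U.map_dag, ← U.map_dag, ← Category.assoc, ← Functor.map_comp,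
      hf.counit]

end FibreFunctor

/-! ### Matrix entries of a unitary pseudonatural transformation -/

namespace UPT

open Hilb

variable {C : Type*} [Category C] [MonoidalCategory C] [DaggerCategory C] [Preadditive C]
  [Linear ℂ C] {F₁ F₂ : FibreFunctor C} (α : UPT F₁ F₂) {ι : Type} [Fintype ι] [DecidableEq ι]
  (b : OrthonormalBasis ι ℂ α.H)

/-- The entries `α_X^{jk} : F₁(X) → F₂(X)`. -/
def mat (X : C) (j k : ι) : F₁.F.obj X ⟶ F₂.F.obj X := entry b (α.comp X) j k

lemma mat_naturality {X Y : C} (f : X ⟶ Y) (j k : ι) :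
    F₁.F.map f ≫ α.mat b Y j k = α.mat b X j k ≫ F₂.F.map f := by
  apply hom_ext
  refine LinearMap.ext fun x => ?_
  have h := congrArg (bra b _ j)
    (LinearMap.congr_fun (congrArg Hom.lin (α.naturality f)) (x ⊗ₜ[ℂ] b k))
  refine h.trans ?_
  change bra b _ j ((α.H ◁ F₂.F.map f).lin ((α.comp X).lin (x ⊗ₜ[ℂ] b k))) = _
  rw [lin_tmul b, map_sum]
  exact bra_sum b j fun i => (F₂.F.map f).lin ((α.mat b X i k).lin x)

/-- The two components act in series on the H wire, which in coordinates is matrix multiplication; j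
is the index on the intermediate wire. -/
lemma mat_monoidality (X Y : C) (i k : ι) :
    F₁.μ X Y ≫ α.mat b (X ⊗ Y) i k = ∑ j, (α.mat b X i j ⊗ₘ α.mat b Y j k) ≫ F₂.μ X Y := by
  apply hom_ext
  refine TensorProduct.ext' fun x y => ?_
  have h := congrArg (bra b _ i)
    (LinearMap.congr_fun (congrArg Hom.lin (α.monoidality X Y)) ((x ⊗ₜ[ℂ] y) ⊗ₜ[ℂ] b k))
  refine h.trans ?_
  change bra b _ i (((α_ (F₁.F.obj X) α.H (F₂.F.obj Y)).inv ≫ α.comp X ▷ F₂.F.obj Y ≫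
    (α_ α.H (F₂.F.obj X) (F₂.F.obj Y)).hom ≫ α.H ◁ F₂.μ X Y).lin
      (x ⊗ₜ[ℂ] (α.comp Y).lin (y ⊗ₜ[ℂ] b k))) = _
  rw [lin_tmul b, TensorProduct.tmul_sum, map_sum, map_sum, sum_lin_apply]
  refine Finset.sum_congr rfl fun j _ => ?_
  change bra b _ i (((α_ α.H (F₂.F.obj X) (F₂.F.obj Y)).hom ≫ α.H ◁ F₂.μ X Y).lin
      ((α.comp X).lin (x ⊗ₜ[ℂ] b j) ⊗ₜ[ℂ] (α.mat b Y j k).lin y)) = _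
  rw [lin_tmul b, TensorProduct.sum_tmul, map_sum]
  exact bra_sum b i fun l =>
    (F₂.μ X Y).lin ((α.mat b X l j).lin x ⊗ₜ[ℂ] (α.mat b Y j k).lin y)

lemma mat_unitality (i k : ι) :
    F₁.υ ≫ α.mat b (𝟙_ C) i k = if i = k then F₂.υ else 0 := by
  apply hom_ext
  refine LinearMap.ext_ring ?_
  have h := congrArg (bra b _ i)
    (LinearMap.congr_fun (congrArg Hom.lin α.unitality) ((1 : ℂ) ⊗ₜ[ℂ] b k))
  refine h.trans ?_
  change bra b _ i (((1 : ℂ) • b k) ⊗ₜ[ℂ] F₂.υ.lin (1 : ℂ)) = _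
  rw [one_smul, bra_tmul, orthonormal_iff_ite.mp b.orthonormal]
  split <;> simp

/-- Unitarity of both multiplicators moves them to the other sides of the equation. This form is the
one that meets the adjoint of the image multiplication. -/
lemma mat_monoidality_dag (X Y : C) (i k : ι) :
    α.mat b (X ⊗ Y) i k ≫ dag (F₂.μ X Y) =
      ∑ j, dag (F₁.μ X Y) ≫ (α.mat b X i j ⊗ₘ α.mat b Y j k) := by
  have h := congrArg (fun g => dag (F₁.μ X Y) ≫ g ≫ dag (F₂.μ X Y)) (α.mat_monoidality b X Y i k)
  simp only [Preadditive.sum_comp, Preadditive.comp_sum, Category.assoc] at h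
  rw [← Category.assoc, (F₁.μ_unitary X Y).2, Category.id_comp] at h
  simpa only [(F₂.μ_unitary X Y).1, Category.comp_id] using h

lemma mat_unitality_dag (i k : ι) :
    α.mat b (𝟙_ C) i k ≫ dag F₂.υ = if i = k then dag F₁.υ else 0 := by
  have h := congrArg (fun g => dag F₁.υ ≫ g ≫ dag F₂.υ) (α.mat_unitality b i k)
  simp only [Category.assoc] at h
  rw [← Category.assoc, F₁.ε_unitary.2, Category.id_comp] at h
  rw [h]
  split
  · rw [F₂.ε_unitary.1, Category.comp_id]
  · simp

lemma mat_isometry (X : C) :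
    ∑ j, ∑ k, α.mat b X j k ≫ dag (α.mat b X j k) = Fintype.card ι • 𝟙 (F₁.F.obj X) := by
  rw [Finset.sum_comm]
  simp only [mat, sum_entry_comp_dag b (α.isUnitary X).1, Finset.sum_const, Finset.card_univ]

lemma mat_coisometry (X : C) :
    ∑ j, ∑ k, dag (α.mat b X j k) ≫ α.mat b X j k = Fintype.card ι • 𝟙 (F₂.F.obj X) := by
  simp only [mat, sum_dag_comp_entry b (α.isUnitary X).2, Finset.sum_const, Finset.card_univ]

/-- Each algebraic clause is naturality at one of m, m†, u, u† followed by monoidality or unitality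
in plain or daggered form. The dagger clauses rely on fibre functors preserving adjoints. -/
lemma unitaryMatrixHom (A : FrobAlg C) :
    UnitaryMatrixHom (F₁.mapFrob A) (F₂.mapFrob A) (α.mat b A.X) where
  mul i k := by
    change (F₁.μ A.X A.X ≫ F₁.F.map A.m) ≫ α.mat b A.X i k =
      ∑ j, (α.mat b A.X i j ⊗ₘ α.mat b A.X j k) ≫ F₂.μ A.X A.X ≫ F₂.F.map A.m
    rw [Category.assoc, mat_naturality, ← Category.assoc, mat_monoidality, Preadditive.sum_comp]
    simp only [Category.assoc]
  comul i k := by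
    change α.mat b A.X i k ≫ dag (F₂.μ A.X A.X ≫ F₂.F.map A.m) =
      ∑ j, dag (F₁.μ A.X A.X ≫ F₁.F.map A.m) ≫ (α.mat b A.X i j ⊗ₘ α.mat b A.X j k)
    rw [dag_comp, dag_comp, ← F₁.map_dag, ← F₂.map_dag, ← Category.assoc, ← mat_naturality,
      Category.assoc, mat_monoidality_dag, Preadditive.comp_sum]
    simp only [Category.assoc]
  unit i k := by
    change (F₁.υ ≫ F₁.F.map A.u) ≫ α.mat b A.X i k = if i = k then F₂.υ ≫ F₂.F.map A.u else 0
    rw [Category.assoc, mat_naturality, ← Category.assoc, mat_unitality]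
    split <;> simp
  counit i k := by
    change α.mat b A.X i k ≫ dag (F₂.υ ≫ F₂.F.map A.u) =
      if i = k then dag (F₁.υ ≫ F₁.F.map A.u) else 0
    rw [dag_comp, dag_comp, ← F₁.map_dag, ← F₂.map_dag, ← Category.assoc, ← mat_naturality,
      Category.assoc, mat_unitality_dag]
    split <;> simp
  isometry := α.mat_isometry b A.X
  coisometry := α.mat_coisometry b A.X

/-- The cup emits |j⟩ twice, once as output and once as row index of α†, while the cap matches the
column index emitted by α† with the incoming |k⟩. The two bends undo the transposition of indices in
the adjoint. -/
lemma entry_dualComp (X : C) (j k : ι) :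
    entry b (α.dualComp b X) j k = dag (α.mat b X j k) := by
  refine entry_eq b (f := fun j k => dag (α.mat b X j k)) (fun y k => ?_) j k
  change ((α_ α.H α.H (F₂.F.obj X ⊗ α.H)).hom ≫
    α.H ◁ ((α_ _ _ _).inv ≫ dag (α.comp X) ▷ α.H ≫ (α_ _ _ _).hom ≫
      F₁.F.obj X ◁ cap b ≫ (ρ_ _).hom)).lin
    (((1 : ℂ) • ∑ i, b i ⊗ₜ[ℂ] b i) ⊗ₜ[ℂ] (y ⊗ₜ[ℂ] b k)) = _
  rw [one_smul, TensorProduct.sum_tmul, map_sum]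
  refine Finset.sum_congr rfl fun i _ => ?_
  change b i ⊗ₜ[ℂ] ((α_ _ _ _).hom ≫ F₁.F.obj X ◁ cap b ≫ (ρ_ _).hom).lin
    ((dag (α.comp X)).lin (b i ⊗ₜ[ℂ] y) ⊗ₜ[ℂ] b k) = _
  congr 1
  rw [dag_lin_tmul, TensorProduct.sum_tmul, map_sum]
  have : ∀ l, ((α_ _ _ _).hom ≫ F₁.F.obj X ◁ cap b ≫ (ρ_ _).hom).lin
      (((dag (entry b (α.comp X) i l)).lin y ⊗ₜ[ℂ] b l) ⊗ₜ[ℂ] b k) =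
      (show ℂ from (cap b).lin (b l ⊗ₜ[ℂ] b k)) • (dag (entry b (α.comp X) i l)).lin y :=
    fun _ => rfl
  simp only [this, cap_tmul, capVal_basis]
  simp [mat]

lemma u_tmul (A : FrobAlg C) (x : F₁.F.obj A.X) (j k : ι) :
    (α.u b A).lin (x ⊗ₜ[ℂ] (b j ⊗ₜ[ℂ] b k)) = sqrtDim α.H • (α.mat b A.X j k).lin x :=
  bend_tmul b _ x j k

lemma v_tmul (A : FrobAlg C) (y : F₂.F.obj A.X) (j k : ι) :
    (α.v b A).lin (y ⊗ₜ[ℂ] (b j ⊗ₜ[ℂ] b k)) = sqrtDim α.H • (dag (α.mat b A.X j k)).lin y := by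
  rw [← entry_dualComp]
  exact bend_tmul b _ y j k

end UPT

/-! ### The coding identity and the proof of the theorem. -/

namespace Hilb

variable {H : Hilb} {ι : Type} [Fintype ι] (b : OrthonormalBasis ι ℂ H)

lemma maxEnt_one : (maxEnt b).lin (1 : ℂ) =
    ((Module.finrank ℂ H : ℂ) ^ 2)⁻¹ •
      ∑ i, ∑ j, (b i ⊗ₜ[ℂ] b j) ⊗ₜ[ℂ] (b i ⊗ₜ[ℂ] b j) := by
  change ((Module.finrank ℂ H : ℂ) ^ 2)⁻¹ • (tensorμ H H H H).lin
    (((1 : ℂ) • ∑ i, b i ⊗ₜ[ℂ] b i) ⊗ₜ[ℂ] ((1 : ℂ) • ∑ i, b i ⊗ₜ[ℂ] b i)) = _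
  rw [one_smul, TensorProduct.sum_tmul, map_sum]
  congr 1
  refine Finset.sum_congr rfl fun i _ => ?_
  rw [TensorProduct.tmul_sum, map_sum]
  exact Finset.sum_congr rfl fun j _ => tensorμ_tmul _ _ _ _

/-- Encoding and decoding by matrices of maps, assisted by the maximally entangled state. -/
lemma simulation_eq [Nontrivial H] {X Y A B : Hilb} (E : X ⊗ (H ⊗ H) ⟶ A) (D : B ⊗ (H ⊗ H) ⟶ Y)
    (N : A ⟶ B) (T : X ⟶ Y) (γ : ι → ι → (X ⟶ A)) (θ : ι → ι → (B ⟶ Y))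
    (hE : ∀ x j k, E.lin (x ⊗ₜ[ℂ] (b j ⊗ₜ[ℂ] b k)) = sqrtDim H • (γ j k).lin x)
    (hD : ∀ y j k, D.lin (y ⊗ₜ[ℂ] (b j ⊗ₜ[ℂ] b k)) = sqrtDim H • (θ j k).lin y)
    (h : ∑ i, ∑ j, γ i j ≫ N ≫ θ i j = Fintype.card ι • T) :
    (ρ_ X).inv ≫ X ◁ maxEnt b ≫ (α_ X (H ⊗ H) (H ⊗ H)).inv ≫
      E ▷ (H ⊗ H) ≫ N ▷ (H ⊗ H) ≫ D = T := by
  apply hom_ext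
  refine LinearMap.ext fun x => ?_
  change ((α_ X (H ⊗ H) (H ⊗ H)).inv ≫ E ▷ (H ⊗ H) ≫ N ▷ (H ⊗ H) ≫ D).lin
    (x ⊗ₜ[ℂ] (maxEnt b).lin (1 : ℂ)) = _
  have hcard : (Module.finrank ℂ H : ℂ) = Fintype.card ι := by
    rw [Module.finrank_eq_card_basis b.toBasis]
  have hne : (Fintype.card ι : ℂ) ≠ 0 := by
    rw [← hcard]
    exact_mod_cast (Module.finrank_pos (R := ℂ) (M := H)).ne'
  have hsq : sqrtDim H * sqrtDim H = Fintype.card ι := by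
    rw [← hcard, sqrtDim, ← Complex.ofReal_mul, Real.mul_self_sqrt (Nat.cast_nonneg _)]
    simp
  -- Encoding and decoding contribute √d each. The resulting d, the factor d from `h` and the
  -- normalisation d⁻² of the entangled state multiply to 1.
  have e : ∀ i j, ((α_ X (H ⊗ H) (H ⊗ H)).inv ≫ E ▷ (H ⊗ H) ≫ N ▷ (H ⊗ H) ≫ D).lin
      (x ⊗ₜ[ℂ] ((b i ⊗ₜ[ℂ] b j) ⊗ₜ[ℂ] (b i ⊗ₜ[ℂ] b j))) =
      (Fintype.card ι : ℂ) • (γ i j ≫ N ≫ θ i j).lin x := by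
    intro i j
    change D.lin (N.lin (E.lin (x ⊗ₜ[ℂ] (b i ⊗ₜ[ℂ] b j))) ⊗ₜ[ℂ] (b i ⊗ₜ[ℂ] b j)) = _
    rw [hE, map_smul, hD, map_smul, smul_smul, hsq]
    rfl
  rw [maxEnt_one, TensorProduct.tmul_smul, map_smul]
  simp only [TensorProduct.tmul_sum, map_sum, e]
  have h' := LinearMap.congr_fun (congrArg Hom.lin h) x
  simp only [sum_lin, LinearMap.sum_apply] at h'
  simp only [← Finset.smul_sum]
  rw [h', smul_smul, hcard, ← Nat.cast_smul_eq_nsmul ℂ, smul_lin, LinearMap.smul_apply, smul_smul]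
  field_simp
  simp

end Hilb

/-- Entanglement-assisted coding schemes from a unitary pseudonatural transformation, over any
monoidal dagger category. -/
theorem UPT.isCodingScheme {C : Type*} [Category C] [MonoidalCategory C] [DaggerCategory C]
    [Preadditive C] [Linear ℂ C] {F₁ F₂ : FibreFunctor C} (α : UPT F₁ F₂) [Nontrivial α.H]
    {ι : Type} [Fintype ι] (b : OrthonormalBasis ι ℂ α.H) {A₁ A₂ : FrobAlg C}
    (hA₁ : A₁.IsSpecial) (hA₂ : A₂.IsSpecial) (f : A₁.X ⟶ A₂.X) :
    Hilb.IsCodingScheme b (X := F₁.mapFrob A₁) (Y := F₁.mapFrob A₂)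
        (A := F₂.mapFrob A₁) (B := F₂.mapFrob A₂)
        (α.u b A₁) (α.v b A₂) (F₁.F.map f) (F₂.F.map f) ∧
      Hilb.IsCodingScheme b (X := F₂.mapFrob A₁) (Y := F₂.mapFrob A₂)
        (A := F₁.mapFrob A₁) (B := F₁.mapFrob A₂)
        (α.v b A₁) (α.u b A₂) (F₂.F.map f) (F₁.F.map f) := by
  classical
  have : Nonempty ι := b.toBasis.index_nonempty
  have hu : ∀ {A : FrobAlg C}, A.IsSpecial → FrobAlg.IsChannel
      (Hilb.tensorFrob (F₁.mapFrob A) (Hilb.bounded b)) (F₂.mapFrob A) (α.u b A) := fun {A} hA =>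
    (α.unitaryMatrixHom b A).matrixStarHom.isChannel b (F₁.mapFrob_isSpecial hA) _ (α.u_tmul b A)
  -- The entries of the dual transformation form the adjoint matrix, so the same channel criterion
  -- applies with source and target exchanged.
  have hv : ∀ {A : FrobAlg C}, A.IsSpecial → FrobAlg.IsChannel
      (Hilb.tensorFrob (F₂.mapFrob A) (Hilb.bounded b)) (F₁.mapFrob A) (α.v b A) := fun {A} hA =>
    (α.unitaryMatrixHom b A).adjoint.matrixStarHom.isChannel b
      (F₂.mapFrob_isSpecial hA) _ (α.v_tmul b A)
  refine ⟨⟨hu hA₁, hv hA₂, ?_⟩, ⟨hv hA₁, hu hA₂, ?_⟩⟩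
  · refine Hilb.simulation_eq b _ _ _ _ _ _ (α.u_tmul b A₁) (α.v_tmul b A₂) ?_
    -- Naturality pulls the image of f in front of the sum and leaves the isometry sum for the
    -- target algebra.
    have e : ∀ i j, α.mat b A₁.X i j ≫ F₂.F.map f ≫ dag (α.mat b A₂.X i j) =
        F₁.F.map f ≫ α.mat b A₂.X i j ≫ dag (α.mat b A₂.X i j) := fun i j => by
      rw [← Category.assoc, ← mat_naturality, Category.assoc]
    change ∑ i, ∑ j, α.mat b A₁.X i j ≫ F₂.F.map f ≫ dag (α.mat b A₂.X i j) =
      Fintype.card ι • F₁.F.map f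
    simp only [e, ← Preadditive.comp_sum, mat_isometry]
    rw [Preadditive.comp_nsmul, Category.comp_id]
  · refine Hilb.simulation_eq b _ _ _ _ _ _ (α.v_tmul b A₁) (α.u_tmul b A₂) ?_
    change ∑ i, ∑ j, dag (α.mat b A₁.X i j) ≫ F₁.F.map f ≫ α.mat b A₂.X i j =
      Fintype.card ι • F₂.F.map f
    -- Here the image of f is pushed behind the sum, leaving the coisometry sum for the source
    -- algebra.
    simp only [mat_naturality]
    simp only [← Category.assoc, ← Preadditive.sum_comp, mat_coisometry]
    rw [Preadditive.nsmul_comp, Category.id_comp]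

end EntSym

end

theorem mainTheorem3 (A : Type*) [Ring A] [HopfAlgebra ℂ A] [StarRing A] [StarModule ℂ A]
    [EntSym.IsCQGAlgebra A]
    (F' : EntSym.FibreFunctor (EntSym.UCorep A))
    (α : EntSym.UPT (EntSym.canonicalFibre A) F') [Nontrivial α.H]
    {ι : Type} [Fintype ι] (b : OrthonormalBasis ι ℂ α.H)
    (A₁ A₂ : EntSym.FrobAlg (EntSym.UCorep A))
    (hA₁ : A₁.IsSpecial ∧ A₁.IsStandard) (hA₂ : A₂.IsSpecial ∧ A₂.IsStandard)
    (f : A₁.X ⟶ A₂.X) (hf : EntSym.FrobAlg.IsChannel A₁ A₂ f) :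
    EntSym.FrobAlg.IsChannel ((EntSym.canonicalFibre A).mapFrob A₁)
      ((EntSym.canonicalFibre A).mapFrob A₂) ((EntSym.canonicalFibre A).F.map f) ∧
    EntSym.FrobAlg.IsChannel (F'.mapFrob A₁) (F'.mapFrob A₂) (F'.F.map f) ∧
    EntSym.Hilb.IsCodingScheme b
      (X := (EntSym.canonicalFibre A).mapFrob A₁) (Y := (EntSym.canonicalFibre A).mapFrob A₂)
      (A := F'.mapFrob A₁) (B := F'.mapFrob A₂)
      (α.u b A₁) (α.v b A₂) ((EntSym.canonicalFibre A).F.map f) (F'.F.map f) ∧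
    EntSym.Hilb.IsCodingScheme b
      (X := F'.mapFrob A₁) (Y := F'.mapFrob A₂)
      (A := (EntSym.canonicalFibre A).mapFrob A₁) (B := (EntSym.canonicalFibre A).mapFrob A₂)
      (α.v b A₁) (α.u b A₂) (F'.F.map f) ((EntSym.canonicalFibre A).F.map f) := by
  obtain ⟨h₁, h₂⟩ := α.isCodingScheme b hA₁.1 hA₂.1 f
  exact ⟨(EntSym.canonicalFibre A).mapFrob_isChannel hf, F'.mapFrob_isChannel hf, h₁, h₂⟩
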